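/- **Setting.** Let $\sigma$ be one of the Pauli operators $\sigma_x,\sigma_y,\sigma_z$ and $H=\tfrac12\sigma$. An encoding gate with prefactor $c\in\mathbb R$ is $e^{icxH}$ acting on one qubit. A circuit on $q$ qubits with $L$ encoding gates is $U(x)=W_L S_{L-1}(x)W_{L-1}\cdots S_0(x)W_0$, where $S_i(x)$ is an encoding gate with prefactor $c_i$ on some qubit and the ansatz layers $W_i$ are arbitrary unitaries on the $q$ qubits. Its model output for a Hermitian observable $M$ is $f(x)=\langle 0|U(x)^\dagger M U(x)|0\rangle$. The circuit is *trainable-frequency* if the prefactors $c_i=\alpha_i$ are arbitrary reals, *ternary fixed-frequency* if each $c_i$ is a power of three $3^{e_i}$, $e_i\in\mathbb N$ (a power may occur several times), and *unary fixed-frequency* if each $c_i=1$. The frequency spectrum $\Omega$ generated by the encoding gates is the set of all $\sum_j c_j(a_j-b_j)$ with $a_j,b_j$ eigenvalues of $H$. Inputs are $x\in[0,1]$. **Proposition (Ternary Fixed-Frequency Requirements).** There is an absolute constant $C>0$ such that the following hold. 1. *One gate.* For all $A\ge 1$ and $0<\varepsilon\le\frac12$ there is a finite sequence of $k\le C(\log_3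 A+\log_3(1/\varepsilon))$ ternary prefactors $3^{e_1},\dots,3^{e_k}$, whose set of values is $\{3^0,\dots,3^{m-1}\}$ for some $m$, such that for every $\sigma$ and every $\alpha\in\mathbb R$ with $|\alpha|\le A$ there are $W_0,\dots,W_k\in U(2)$ for which the single-qubit circuit $U$ with these fixed prefactors satisfies $\|U(x)-e^{i\alpha xH}\|_F\le\varepsilon$ for all $x\in[0,1]$. 2. *Complete circuit.* For all integers $k_{\rm opt}\ge1$ and all $0<\varepsilon\le\frac12$ there are an integer $k_{\rm unary}\ge0$ and a sequence of $k$ ternary prefactors, whose set of values is $\{3^0,\dots,3^{m-1}\}$ for some $m$, with $$k\le C\,k_{\rm opt}\bigl(\log_3 k_{\rm opt}+\log_3(1/\varepsilon)\bigr),\qquad k_{\rm unary}\le C\,\bigl(k_{\rm opt}^2+k_{\rm opt}\,\varepsilon^{-2}\bigr),$$ such that for every $\sigma$: (a) every trainable-frequency circuit $V$ with $k_{\rm opt}$ encoding gates and prefactors $|\alpha_i|\le k_{\rm opt}$, on any number of qubits, is approximated on the same qubits both by a circuit $U$ with these $k$ ternary gates and by a circuit $U$ with $k_{\rm unary}$ unary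 gates, in the sense that for all $x\in[0,1]$ one has $\|U(x)-V(x)\|\le\varepsilon$ in operator norm, and for every Hermitian $M$ the model outputs at $x$ differ by at most $\varepsilon\|M\|$; (b) the ternary gates generate the same frequency spectrum as the $k_{\rm unary}$ unary gates, $\Omega=\{-k_{\rm unary},\dots,k_{\rm unary}\}$, of size $|\Omega|=2k_{\rm unary}+1$, and every model output of a circuit with these ternary gates has the form $\sum_{n=-k_{\rm unary}}^{k_{\rm unary}}c_n e^{inx}$ for all $x\in\mathbb R$; (c) the ansatz requires $2k_{\rm unary}+1$ parameters: this is exactly the smallest number $p$ for which some number of qubits, some placement of these ternary gates, some observable and some ansatz whose layers depend smoothly on real parameters, $p$ of them in total, give independent control of all Fourier coefficients. Independent control means that there are a family $(c^0_n)_{n\in\Omega}$ with $c^0_{-n}=\overline{c^0_n}$ and a $\delta>0$ such that each family $(c_n)_{n\in\Omega}$ with $c_{-n}=\overline{c_n}$ and $|c_n-c^0_n|<\delta$ for all $n\in\Omega$ is the coefficient family of the model output at some parameter value. -/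

import Mathlib

namespace TernaryVQC

/-- The three nontrivial Pauli operators. -/
inductive Pauli
  | X
  | Y
  | Z

/-- The Pauli matrices. -/
def Pauli.mat : Pauli → Matrix (Fin 2) (Fin 2) ℂ
  | .X => !![0, 1; 1, 0]
  | .Y => !![0, -Complex.I; Complex.I, 0]
  | .Z => !![1, 0; 0, -1]

/-- The encoding generator `H = σ / 2`. -/
noncomputable def Pauli.gen (P : Pauli) : Matrix (Fin 2) (Fin 2) ℂ := (1 / 2 : ℂ) • P.mat

/-- Labels of the computational basis of `q` qubits. -/
abbrev Basis (q : ℕ) : Type := Fin q → Fin 2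

/-- The operator acting as `A` on qubit `l` and as the identity on all the other qubits. -/
def onQubit {q : ℕ} (l : Fin q) (A : Matrix (Fin 2) (Fin 2) ℂ) : Matrix (Basis q) (Basis q) ℂ :=
  Matrix.of fun a b => if ∀ j, j ≠ l → a j = b j then A (a l) (b l) else 0

/-- The encoding gate `exp (i c x H)` with prefactor `c` and generator `H`. -/
noncomputable def encGate {ι : Type} [Fintype ι] [DecidableEq ι]
    (H : Matrix ι ι ℂ) (c x : ℝ) : Matrix ι ι ℂ :=
  NormedSpace.exp ((Complex.I * (c : ℂ) * (x : ℂ)) • H)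

/-- The interleaved product `W_L S_{L-1} W_{L-1} ⋯ S_1 W_1 S_0 W_0`. -/
def interleave {ι : Type} [Fintype ι] [DecidableEq ι] :
    (L : ℕ) → (Fin L → Matrix ι ι ℂ) → (Fin (L + 1) → Matrix.unitaryGroup ι ℂ) → Matrix ι ι ℂ
  | 0, _, W => (W 0 : Matrix ι ι ℂ)
  | L + 1, S, W =>
      (W (Fin.last (L + 1)) : Matrix ι ι ℂ) * S (Fin.last L) *
        interleave L (fun i => S i.castSucc) (fun i => W i.castSucc)

/-- The `q`-qubit circuit with `L` encoding gates: the `i`-th gate is the Pauli rotation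
`exp (i c_i x σ / 2)` on qubit `loc i`; `W` is the list of ansatz layers. Fixed-frequency and
trainable-frequency circuits differ only in where the prefactors `c` come from. -/
noncomputable def circuit {q L : ℕ} (P : Pauli) (loc : Fin L → Fin q) (c : Fin L → ℝ)
    (W : Fin (L + 1) → Matrix.unitaryGroup (Basis q) ℂ) (x : ℝ) : Matrix (Basis q) (Basis q) ℂ :=
  interleave L (fun i => encGate (onQubit (loc i) P.gen) (c i) x) W

/-- The model output `⟨0| U† M U |0⟩`. -/
def output {q : ℕ} (M U : Matrix (Basis q) (Basis q) ℂ) : ℂ :=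
  (U.conjTranspose * M * U) (fun _ => 0) (fun _ => 0)

/-- The Frobenius norm `√ Tr (A† A)`. -/
noncomputable def frobNorm {ι : Type} [Fintype ι] (A : Matrix ι ι ℂ) : ℝ :=
  Real.sqrt (A.conjTranspose * A).trace.re

/-- The operator norm with respect to the Euclidean norm. -/
noncomputable def opNorm {ι : Type} [Fintype ι] [DecidableEq ι] (A : Matrix ι ι ℂ) : ℝ :=
  ‖Matrix.toEuclideanCLM (n := ι) (𝕜 := ℂ) A‖

/-- The prefactors `3 ^ e_j` of ternary fixed-frequency gates. -/
noncomputable def ternary {k : ℕ} (e : Fin k → ℕ) : Fin k → ℝ := fun j => 3 ^ e j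

/-- The unit prefactors of `k` unary fixed-frequency gates. -/
def unary (k : ℕ) : Fin k → ℝ := fun _ => 1

/-- The `x`-dependent unitary `V x` on `q` qubits is approximated up to `ε` on `[0, 1]` by some
circuit on the same qubits whose encoding gates have the prescribed prefactors `c`: both the
unitary itself, in operator norm, and the model output of every observable `M`, relative to the
norm of `M`. Only the qubits acted on and the ansatz layers are adapted to `V`. -/
def ApproxBy {q k : ℕ} (ε : ℝ) (P : Pauli) (c : Fin k → ℝ)
    (V : ℝ → Matrix (Basis q) (Basis q) ℂ) : Prop :=
  ∃ (loc : Fin k → Fin q) (W : Fin (k + 1) → Matrix.unitaryGroup (Basis q) ℂ),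
    ∀ x ∈ Set.Icc (0 : ℝ) 1,
      opNorm (circuit P loc c W x - V x) ≤ ε ∧
      ∀ M : Matrix (Basis q) (Basis q) ℂ, M.IsHermitian →
        ‖output M (circuit P loc c W x) - output M (V x)‖ ≤ ε * opNorm M

/-- The frequency spectrum generated by encoding gates with prefactors `c`: all differences of
sums of eigenvalues of the encoding Hamiltonians `c_j σ / 2`. -/
def freqSpectrum {k : ℕ} (P : Pauli) (c : Fin k → ℝ) : Set ℝ :=
  {ω | ∃ a b : Fin k → ℝ, (∀ j, a j ∈ spectrum ℝ P.gen) ∧ (∀ j, b j ∈ spectrum ℝ P.gen) ∧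
    ω = ∑ j, c j * a j - ∑ j, c j * b j}

/-- The trigonometric polynomial `∑_{|n| ≤ K} c_n e^{i n x}`. -/
noncomputable def trigPoly (K : ℕ) (c : ℤ → ℂ) (x : ℝ) : ℂ :=
  ∑ n ∈ Finset.Icc (-(K : ℤ)) (K : ℤ), c n * Complex.exp (Complex.I * (n : ℂ) * (x : ℂ))

/-- Some smoothly parametrized ansatz with `p` real parameters in total (`d j` of them in layer
`j`), on some number of qubits and with some observable, gives independent control of all the
Fourier coefficients with frequencies `-K, …, K` in a circuit with encoding prefactors `c`: every
family of coefficients near some base point that belongs to a real-valued function, that is, with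
`c_{-n}` the conjugate of `c_n`, is realized. (All families cannot be realized, because the output
is bounded by the norm of the observable.) -/
def ControlsCoeffs {k : ℕ} (P : Pauli) (c : Fin k → ℝ) (K p : ℕ) : Prop :=
  ∃ (q : ℕ) (loc : Fin k → Fin q) (d : Fin (k + 1) → ℕ)
    (W : (j : Fin (k + 1)) → (Fin (d j) → ℝ) → Matrix.unitaryGroup (Basis q) ℂ)
    (M : Matrix (Basis q) (Basis q) ℂ),
    (∀ j a b, ContDiff ℝ ((⊤ : ℕ∞) : WithTop ℕ∞)
      (fun t => (W j t : Matrix (Basis q) (Basis q) ℂ) a b)) ∧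
    M.IsHermitian ∧
    ∑ j, d j = p ∧
    ∃ (c₀ : ℤ → ℂ) (δ : ℝ), (∀ n, c₀ (-n) = star (c₀ n)) ∧ 0 < δ ∧
      ∀ c₁ : ℤ → ℂ, (∀ n, c₁ (-n) = star (c₁ n)) → (∀ n, ‖c₁ n - c₀ n‖ < δ) →
        ∃ θ : (j : Fin (k + 1)) → Fin (d j) → ℝ,
          ∀ x : ℝ, output M (circuit P loc c (fun j => W j (θ j)) x) = trigPoly K c₁ x

end TernaryVQC

/-!
The gates of a fixed-frequency circuit are handled through the predicate `Realizable G l F`: the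
`x`-dependent matrix `F` is a product of constant unitaries and of gates `exp (i 3 ^ e x H)`, one
for each `e` in the list `l`. Since `exp (i 3 ^ e x H)` is a product of `3 ^ e` unit gates,
whatever a list `l` of ternary gates realizes is realized by `K = ∑ 3 ^ e` unary gates
(`Realizable.toUnary`).

One gate `exp (i α x σ / 2)` is, up to a change of basis, the diagonal matrix with entries
`exp (i α x / 2)` and `exp (-i α x / 2)`. Write `α / 2 = t + b` with `t` an integer and `|b| ≤ 1 / 2`. The factor `exp (i t x)` is
*exactly* a product of two gates for each power of three, oriented by the balanced ternary digits
of `t` (`realizable_integer`). The factor `exp (i b x)` does not have an integer frequency and is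
approximated on `[0, 1]` by a trigonometric polynomial. With `s = sin (x - 1 / 2)`, which
satisfies `|s| ≤ 1 / 2` there, `exp (i b (x - 1 / 2)) = exp (i b arcsin s)`, and the Taylor
polynomials of the latter at `s = 0` converge at rate `|s| ^ n`; they exceed modulus `1` by at
most `|s| ^ n` on all of `[-1, 1]`, so that the damping factor `1 - s ^ n` makes them bounded by
`1` (`exists_bounded_poly`). A polynomial `p` in `exp (i x)` of modulus less than `1` is
completed to a unit vector `(p, q)` by the Fejér–Riesz theorem (`exists_complementary`), and a
polynomial unit vector of degree `K` is the first column of a circuit with `K` unary gates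
(`realizable_quat_of_unit_vector`, the quantum signal processing theorem, by induction on `K`).
Altogether a block of `O(log A)` ternary gates and `O(log (1 / δ))` unit gates replaces one
trainable gate up to an error `δ` (`exists_gate_approx`, `exists_block`). The difference of two
elements of `SU(2)` is a multiple of a unitary, which gives the Frobenius norm and the operator
norm at once.

A complete circuit is treated gate by gate with `δ = ε / (2 kopt)`; the errors add up because all
factors are unitary (`exists_circuit_approx`). The resulting list of exponents consists of `kopt`
copies of a block. The subset sums of its powers of three are all the integers from `0` to their
total `K` (`FillsInterval`), which determines the spectrum, the same as that of `K` unary gates.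

Independent control of `2 K + 1` real coefficients needs `2 K + 1` parameters because the image of
a smooth map from a space of smaller dimension has dense complement (`le_of_controlsCoeffs`).
Conversely, put the `j`-th gate on a qubit of its own, in the basis in which it is diagonal. Then
the circuit multiplies the amplitude of a computational basis state by a phase, and its phase
differs from that of the state `0` by a subset sum of the prefactors. The first layer prepares a state whose
amplitudes at `0` and at one label for each subset sum `1, …, K` are free, the first column of a
Householder reflection, and an observable supported on the row and the column of `0` turns the
products of amplitudes into the Fourier coefficients (`controlsCoeffs_of_subset_sums`).
-/

namespace TernaryVQC

open Matrix Polynomial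

/-! ### Encoding gates -/

/-- The matrix `!![p, -q̄; q, p̄]`. It lies in `SU(2)` when `|p|² + |q|² = 1`; the matrices of this
shape form a real algebra, the quaternions. -/
def quat (p q : ℂ) : Matrix (Fin 2) (Fin 2) ℂ := !![p, -star q; q, star p]

lemma quat_mul (a b p q : ℂ) :
    quat a b * quat p q = quat (a * p - star b * q) (b * p + star a * q) := by
  ext i j
  fin_cases i <;> fin_cases j <;> simp [quat, Matrix.mul_apply, Fin.sum_univ_two] <;> ring

lemma quat_sub (a b p q : ℂ) : quat a b - quat p q = quat (a - p) (b - q) := by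
  ext i j
  fin_cases i <;> fin_cases j <;> simp [quat]
  ring

lemma quat_conjTranspose_mul_self (p q : ℂ) :
    (quat p q)ᴴ * quat p q = ((‖p‖ ^ 2 + ‖q‖ ^ 2 : ℝ) : ℂ) • 1 := by
  have hp := Complex.conj_mul' p
  have hq := Complex.conj_mul' q
  ext i j
  fin_cases i <;> fin_cases j <;>
    simp [quat, Matrix.mul_apply, Fin.sum_univ_two, ← hp, ← hq] <;> ring

lemma quat_mem_unitaryGroup {p q : ℂ} (h : ‖p‖ ^ 2 + ‖q‖ ^ 2 = 1) :
    quat p q ∈ unitaryGroup (Fin 2) ℂ := by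
  rw [mem_unitaryGroup_iff', star_eq_conjTranspose, quat_conjTranspose_mul_self, h]
  simp

lemma encGate_Z (c x : ℝ) :
    encGate Pauli.Z.gen c x = diagonal (fun i : Fin 2 =>
      Complex.exp (Complex.I * c * x * (if i = 0 then 1 / 2 else -(1 / 2)))) := by
  have h : (Complex.I * (c : ℂ) * (x : ℂ)) • Pauli.Z.gen = diagonal (fun i : Fin 2 =>
      Complex.I * c * x * (if i = 0 then 1 / 2 else -(1 / 2))) := by
    ext i j
    fin_cases i <;> fin_cases j <;> simp [Pauli.gen, Pauli.mat]
  rw [encGate, h, exp_diagonal]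
  congr 1
  ext i
  rw [Pi.coe_exp, Complex.exp_eq_exp_ℂ]

lemma encGate_Z_eq_quat (c x : ℝ) :
    encGate Pauli.Z.gen c x = quat (Complex.exp (Complex.I * c * x / 2)) 0 := by
  rw [encGate_Z]
  ext i j
  fin_cases i <;> fin_cases j <;> simp [quat, ← Complex.exp_conj, map_ofNat] <;> ring_nf

lemma encGate_conj {ι : Type} [Fintype ι] [DecidableEq ι] (B : unitaryGroup ι ℂ)
    (H : Matrix ι ι ℂ) (c x : ℝ) :
    encGate ((B : Matrix ι ι ℂ) * H * star (B : Matrix ι ι ℂ)) c x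
      = B * encGate H c x * star (B : Matrix ι ι ℂ) := by
  have h := exp_units_conj (Unitary.toUnits B) ((Complex.I * (c : ℂ) * (x : ℂ)) • H)
  simpa [encGate, Matrix.mul_smul, Matrix.smul_mul] using h

lemma encGate_add {ι : Type} [Fintype ι] [DecidableEq ι] (H : Matrix ι ι ℂ) (c d x : ℝ) :
    encGate H (c + d) x = encGate H c x * encGate H d x := by
  have h : (Complex.I * ((c + d : ℝ) : ℂ) * (x : ℂ)) • H
      = (Complex.I * (c : ℂ) * (x : ℂ)) • H + (Complex.I * (d : ℂ) * (x : ℂ)) • H := by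
    rw [← add_smul]; push_cast; congr 1; ring
  rw [encGate, h, Matrix.exp_add_of_commute]
  · rfl
  · exact ((Commute.refl H).smul_left _).smul_right _

/-- Every Pauli generator is unitarily equivalent to that of `σ_z`. -/
lemma exists_gen_eq_conj (P : Pauli) : ∃ B : unitaryGroup (Fin 2) ℂ,
    P.gen = (B : Matrix (Fin 2) (Fin 2) ℂ) * Pauli.Z.gen
      * star (B : Matrix (Fin 2) (Fin 2) ℂ) := by
  have hI := Complex.I_mul_I
  cases P with
  | X =>
    refine ⟨⟨((1 + Complex.I) / 2) • !![1, 1; 1, -1], ?_⟩, ?_⟩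
    · rw [mem_unitaryGroup_iff]
      ext i j
      fin_cases i <;> fin_cases j <;>
        simp [star_eq_conjTranspose, Matrix.mul_apply, Fin.sum_univ_two, map_ofNat] <;> grind
    · ext i j
      fin_cases i <;> fin_cases j <;>
        simp [star_eq_conjTranspose, Matrix.mul_apply, Fin.sum_univ_two, Pauli.gen, Pauli.mat,
          map_ofNat] <;> grind
  | Y =>
    refine ⟨⟨((1 + Complex.I) / 2) • !![1, 1; Complex.I, -Complex.I], ?_⟩, ?_⟩
    · rw [mem_unitaryGroup_iff]
      ext i j
      fin_cases i <;> fin_cases j <;>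
        simp [star_eq_conjTranspose, Matrix.mul_apply, Fin.sum_univ_two, map_ofNat] <;> grind
    · ext i j
      fin_cases i <;> fin_cases j <;>
        simp [star_eq_conjTranspose, Matrix.mul_apply, Fin.sum_univ_two, Pauli.gen, Pauli.mat,
          map_ofNat] <;> grind
  | Z => exact ⟨1, by simp⟩

lemma onQubit_eq_kronecker {q : ℕ} (l : Fin q) (A : Matrix (Fin 2) (Fin 2) ℂ) :
    onQubit l A = (kroneckerMap (· * ·) A (1 : Matrix ({j // j ≠ l} → Fin 2) _ ℂ)).submatrix
      (Equiv.funSplitAt l (Fin 2)) (Equiv.funSplitAt l (Fin 2)) := by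
  ext a b
  simp [onQubit, one_apply, funext_iff]

/-- `onQubit l` as a homomorphism of rings. -/
def onQubitHom {q : ℕ} (l : Fin q) :
    Matrix (Fin 2) (Fin 2) ℂ →+* Matrix (Basis q) (Basis q) ℂ where
  toFun := onQubit l
  map_one' := by rw [onQubit_eq_kronecker]; simp
  map_mul' A B := by
    rw [onQubit_eq_kronecker, onQubit_eq_kronecker, onQubit_eq_kronecker, submatrix_mul_equiv,
      ← mul_kronecker_mul, one_mul]
  map_zero' := by ext a b; simp [onQubit]
  map_add' A B := by ext a b; simp only [onQubit, of_apply, Matrix.add_apply]; split <;> simp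

lemma onQubit_mul {q : ℕ} (l : Fin q) (A B : Matrix (Fin 2) (Fin 2) ℂ) :
    onQubit l (A * B) = onQubit l A * onQubit l B := (onQubitHom l).map_mul A B

lemma onQubit_one {q : ℕ} (l : Fin q) : onQubit l 1 = 1 := (onQubitHom l).map_one

lemma onQubit_sub {q : ℕ} (l : Fin q) (A B : Matrix (Fin 2) (Fin 2) ℂ) :
    onQubit l (A - B) = onQubit l A - onQubit l B := (onQubitHom l).map_sub A B

lemma onQubit_smul {q : ℕ} (l : Fin q) (c : ℂ) (A : Matrix (Fin 2) (Fin 2) ℂ) :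
    onQubit l (c • A) = c • onQubit l A := by
  ext a b; simp only [onQubit, of_apply, Matrix.smul_apply]; split <;> simp

lemma onQubit_conjTranspose {q : ℕ} (l : Fin q) (A : Matrix (Fin 2) (Fin 2) ℂ) :
    onQubit l Aᴴ = (onQubit l A)ᴴ := by
  ext a b
  simp only [onQubit, of_apply, conjTranspose_apply, eq_comm]
  split <;> simp

/-- A one-qubit unitary acting on qubit `l`. -/
def onQubitUnitary {q : ℕ} (l : Fin q) (B : unitaryGroup (Fin 2) ℂ) :
    unitaryGroup (Basis q) ℂ :=
  ⟨onQubit l B, by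
    rw [mem_unitaryGroup_iff, star_eq_conjTranspose, ← onQubit_conjTranspose, ← onQubit_mul,
      ← star_eq_conjTranspose, mem_unitaryGroup_iff.1 B.2, onQubit_one]⟩

lemma continuous_onQubit {q : ℕ} (l : Fin q) : Continuous (onQubit l) := by
  refine continuous_pi fun a => continuous_pi fun b => ?_
  by_cases h : ∀ j, j ≠ l → a j = b j
  · simp only [onQubit, of_apply, if_pos h]
    exact (continuous_apply (b l)).comp (continuous_apply (a l))
  · simpa only [onQubit, of_apply, if_neg h] using continuous_const

open scoped Matrix.Norms.L2Operator in
lemma encGate_onQubit {q : ℕ} (l : Fin q) (H : Matrix (Fin 2) (Fin 2) ℂ) (c x : ℝ) :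
    encGate (onQubit l H) c x = onQubit l (encGate H c x) := by
  rw [encGate, ← onQubit_smul]
  let _ : NormedAlgebra ℚ (Matrix (Fin 2) (Fin 2) ℂ) := NormedAlgebra.restrictScalars ℚ ℂ _
  exact (NormedSpace.map_exp (onQubitHom l) (continuous_onQubit l) _).symm

/-! ### Circuits with ternary gates -/

/-- `Realizable G l F`: the `x`-dependent matrix `F` is a product of constant unitaries and of
encoding gates with generators of the family `G`, whose prefactors are `3 ^ e` for `e` running
through the list `l`, the head of the list being the leftmost gate. -/
inductive Realizable {ι κ : Type} [Fintype ι] [DecidableEq ι] (G : κ → Matrix ι ι ℂ) :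
    List ℕ → (ℝ → Matrix ι ι ℂ) → Prop
  | const (W : unitaryGroup ι ℂ) : Realizable G [] (fun _ => (W : Matrix ι ι ℂ))
  | gate (W : unitaryGroup ι ℂ) (g : κ) (e : ℕ) {l : List ℕ} {F : ℝ → Matrix ι ι ℂ} :
      Realizable G l F →
        Realizable G (e :: l) (fun x => (W : Matrix ι ι ℂ) * encGate (G g) (3 ^ e) x * F x)

namespace Realizable

variable {ι κ : Type} [Fintype ι] [DecidableEq ι] {G : κ → Matrix ι ι ℂ}

lemma of_eq {l : List ℕ} {F F' : ℝ → Matrix ι ι ℂ} (h : Realizable G l F)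
    (hF : ∀ x, F x = F' x) : Realizable G l F' := funext hF ▸ h

lemma unitary_mul (W : unitaryGroup ι ℂ) {l : List ℕ} {F : ℝ → Matrix ι ι ℂ}
    (h : Realizable G l F) : Realizable G l (fun x => (W : Matrix ι ι ℂ) * F x) := by
  cases h with
  | const V => exact .const (W * V)
  | gate V g e h => exact (h.gate (W * V) g e).of_eq fun x => by simp [Matrix.mul_assoc]

lemma mul {l l' : List ℕ} {F F' : ℝ → Matrix ι ι ℂ} (h : Realizable G l F)
    (h' : Realizable G l' F') : Realizable G (l ++ l') (fun x => F x * F' x) := by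
  induction h with
  | const W => exact h'.unitary_mul W
  | gate W g e _ ih => simpa only [List.cons_append, Matrix.mul_assoc] using ih.gate W g e

lemma mul_unitary (W : unitaryGroup ι ℂ) {l : List ℕ} {F : ℝ → Matrix ι ι ℂ}
    (h : Realizable G l F) : Realizable G l (fun x => F x * (W : Matrix ι ι ℂ)) := by
  simpa using h.mul (.const W)

/-- Generators may be replaced by unitarily equivalent ones, up to the ansatz layers. -/
lemma of_conj {κ' : Type} {G' : κ' → Matrix ι ι ℂ}
    (hG : ∀ g, ∃ g', ∃ B : unitaryGroup ι ℂ,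
      G g = (B : Matrix ι ι ℂ) * G' g' * star (B : Matrix ι ι ℂ))
    {l : List ℕ} {F : ℝ → Matrix ι ι ℂ} (h : Realizable G l F) : Realizable G' l F := by
  induction h with
  | const W => exact .const W
  | gate W g e _ ih =>
    obtain ⟨g', B, hB⟩ := hG g
    refine ((ih.unitary_mul (star B)).gate (W * B) g' e).of_eq fun x => ?_
    rw [hB, encGate_conj]
    simp only [Matrix.mul_assoc, Submonoid.coe_mul, Unitary.coe_star]

lemma replicate (g : κ) (n : ℕ) :
    Realizable G (List.replicate n 0) (fun x => encGate (G g) n x) := by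
  induction n with
  | zero => simpa [encGate] using Realizable.const (G := G) 1
  | succ n ih =>
    have h := ih.gate 1 g 0
    have hx (x : ℝ) : encGate (G g) ((n + 1 : ℕ) : ℝ) x
        = encGate (G g) 1 x * encGate (G g) n x := by
      rw [← encGate_add, Nat.cast_succ, add_comm]
    refine h.of_eq fun x => ?_
    rw [hx]; simp

/-- A gate with prefactor `3 ^ e` consists of `3 ^ e` gates with prefactor `1`. -/
lemma toUnary {l : List ℕ} {F : ℝ → Matrix ι ι ℂ} (h : Realizable G l F) :
    Realizable G (List.replicate (l.map (3 ^ ·)).sum 0) F := by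
  induction h with
  | const W => exact .const W
  | gate W g e _ ih =>
    have := ((Realizable.replicate g (3 ^ e)).unitary_mul W).mul ih
    simpa [← List.replicate_add] using this

/-- `interleave` lists the gates from right to left, hence the reversal of `l`. -/
lemma exists_interleave {l : List ℕ} {F : ℝ → Matrix ι ι ℂ} (h : Realizable G l F) :
    ∃ (g : Fin l.length → κ) (W : Fin (l.length + 1) → unitaryGroup ι ℂ), ∀ x,
      interleave l.length (fun i => encGate (G (g i)) (ternary (fun i => l.get i.rev) i) x) W
        = F x := by
  induction h with
  | const W => exact ⟨Fin.elim0, fun _ => W, fun _ => rfl⟩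
  | @gate W g e l F _ ih =>
    obtain ⟨g', W', h'⟩ := ih
    refine ⟨Fin.snoc (α := fun _ => κ) g' g,
      Fin.snoc (α := fun _ => unitaryGroup ι ℂ) W' W, fun x => ?_⟩
    simp only [List.length_cons, interleave, Fin.snoc_last, Fin.snoc_castSucc, ← h' x, ternary]
    congr 2
    · simp
    · funext i
      simp [Fin.rev_castSucc]

lemma onQubit {q : ℕ} {H : Matrix (Fin 2) (Fin 2) ℂ} {l : List ℕ}
    {F : ℝ → Matrix (Fin 2) (Fin 2) ℂ} (h : Realizable (fun _ : Unit => H) l F) (j : Fin q) :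
    Realizable (fun j : Fin q => TernaryVQC.onQubit j H) l
      (fun x => TernaryVQC.onQubit j (F x)) := by
  induction h with
  | const W => exact .const (onQubitUnitary j W)
  | gate W g e _ ih =>
    refine (ih.gate (onQubitUnitary j W) j e).of_eq fun x => ?_
    rw [onQubit_mul, onQubit_mul, encGate_onQubit]
    rfl

end Realizable

/-! ### The Fejér–Riesz theorem -/

lemma conj_eq_inv_of_norm_eq_one {z : ℂ} (hz : ‖z‖ = 1) : star z = z⁻¹ := by
  rw [Complex.inv_def, Complex.normSq_eq_norm_sq, hz]; simp

lemma norm_exp_I_mul (x : ℝ) : ‖Complex.exp (Complex.I * x)‖ = 1 := by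
  rw [mul_comm]; exact Complex.norm_exp_ofReal_mul_I x

lemma eval_map_conj (p : ℂ[X]) (z : ℂ) :
    (p.map (starRingEnd ℂ)).eval (star z) = star (p.eval z) := by
  rw [eval_map]
  exact eval₂_at_apply (starRingEnd ℂ) z

/-- On the unit circle `z ^ K * conj (p z)` is a polynomial. -/
lemma eval_reflect_conj {p : ℂ[X]} {K : ℕ} (hp : p.natDegree ≤ K) {z : ℂ} (hz : ‖z‖ = 1) :
    (reflect K (p.map (starRingEnd ℂ))).eval z = z ^ K * star (p.eval z) := by
  have hz0 : z ≠ 0 := by rintro rfl; simp at hz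
  have _ : Invertible (star z) := invertibleOfNonzero (by simpa using hz0)
  have h := eval₂_reflect_mul_pow (RingHom.id ℂ) (star z) K (p.map (starRingEnd ℂ))
    (natDegree_map_le.trans hp)
  rw [← eval, ← eval, eval_map_conj, invOf_eq_inv, conj_eq_inv_of_norm_eq_one hz, inv_inv,
    ← eq_mul_inv_iff_mul_eq₀ (pow_ne_zero _ (inv_ne_zero hz0))] at h
  rw [h, mul_comm, inv_pow, inv_inv]

/-- Polynomials that agree on the unit circle are equal. -/
lemma eq_of_eval_circle {p q : ℂ[X]} (h : ∀ z : ℂ, ‖z‖ = 1 → p.eval z = q.eval z) : p = q := by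
  refine eq_of_infinite_eval_eq p q (Set.Infinite.mono (s := Metric.sphere (0 : ℂ) 1) ?_ ?_)
  · intro z hz
    exact h z (by simpa using hz)
  · have : (Metric.sphere (0 : ℂ) 1).Nontrivial :=
      ⟨1, by simp, -1, by simp, by norm_num⟩
    refine IsPreconnected.infinite_of_nontrivial ?_ this
    exact isPreconnected_sphere (by rw [Complex.rank_real_complex]; norm_num) _ _

lemma natDegree_le_of_coeff_eq_zero {p : ℂ[X]} {K : ℕ} (hp : p.natDegree ≤ K + 1)
    (h : p.coeff (K + 1) = 0) : p.natDegree ≤ K := by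
  refine natDegree_le_iff_coeff_eq_zero.2 fun N hN => ?_
  rcases (Nat.succ_le_of_lt hN).eq_or_lt with rfl | h'
  · exact h
  · exact coeff_eq_zero_of_natDegree_lt (hp.trans_lt h')

/-- The **Fejér–Riesz theorem**: a positive trigonometric polynomial `z ^ (-K) * r z` is the squared
modulus of a polynomial. Since `r` is self-reciprocal, its roots come in pairs `α`, `1 / ᾱ`, and
`(z - α) (1 - ᾱ z) = z |z - α|²` on the circle, so one root of each pair can be split off. -/
theorem fejer_riesz (K : ℕ) (r : ℂ[X]) (hdeg : r.natDegree ≤ 2 * K)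
    (hpos : ∀ z : ℂ, ‖z‖ = 1 → ∃ t : ℝ, 0 < t ∧ r.eval z = z ^ K * t) :
    ∃ q : ℂ[X], q.natDegree ≤ K ∧
      ∀ z : ℂ, ‖z‖ = 1 → r.eval z = z ^ K * ((‖q.eval z‖ ^ 2 : ℝ) : ℂ) := by
  induction K generalizing r with
  | zero =>
    obtain ⟨t, ht, h⟩ := hpos 1 (by simp)
    have hr := eq_C_of_natDegree_le_zero (p := r) (by simpa using hdeg)
    refine ⟨C (Real.sqrt t : ℂ), by simp, fun z _ => ?_⟩
    rw [hr] at h ⊢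
    simp only [eval_C, pow_zero, one_mul] at h ⊢
    rw [h, Complex.norm_real, Real.norm_eq_abs, sq_abs, Real.sq_sqrt ht.le]
  | succ K ih =>
    have hz0 : ∀ z : ℂ, ‖z‖ = 1 → z ≠ 0 := by rintro z hz rfl; simp at hz
    have hrec : reflect (2 * (K + 1)) (r.map (starRingEnd ℂ)) = r := by
      refine eq_of_eval_circle fun z hz => ?_
      obtain ⟨t, -, ht⟩ := hpos z hz
      rw [eval_reflect_conj hdeg hz, ht, star_mul', star_pow, conj_eq_inv_of_norm_eq_one hz,
        Complex.star_def, Complex.conj_ofReal]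
      have := hz0 z hz
      rw [inv_pow, two_mul, pow_add]
      field_simp
    by_cases h0 : r.coeff 0 = 0
    -- the leading coefficient vanishes together with the constant one, and `X` is split off
    · have htop : r.coeff (2 * K + 1 + 1) = 0 := by
        rw [← hrec, coeff_reflect, show 2 * K + 1 + 1 = 2 * (K + 1) by ring, revAt_le le_rfl,
          coeff_map, Nat.sub_self, h0, map_zero]
      have hr : r = X * r.divX := by
        conv_lhs => rw [← divX_mul_X_add r, h0, C_0, add_zero, mul_comm]
      have hev (z : ℂ) : r.eval z = z * r.divX.eval z := by
        conv_lhs => rw [hr]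
        simp
      have hd : r.divX.natDegree ≤ 2 * K := by
        have : r.natDegree ≤ 2 * K + 1 := natDegree_le_of_coeff_eq_zero hdeg htop
        rw [natDegree_divX_eq_natDegree_tsub_one]
        omega
      obtain ⟨q, hq, hqz⟩ := ih r.divX hd fun z hz => by
        obtain ⟨t, ht, h⟩ := hpos z hz
        refine ⟨t, ht, mul_left_cancel₀ (hz0 z hz) ?_⟩
        rw [← hev, h]; ring
      refine ⟨q, hq.trans K.le_succ, fun z hz => ?_⟩
      rw [hev, hqz z hz]; ring
    · have htop : r.coeff (2 * (K + 1)) ≠ 0 := by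
        rw [← hrec, coeff_reflect, revAt_le le_rfl, coeff_map, Nat.sub_self]
        simpa using h0
      have hnat : r.natDegree = 2 * (K + 1) :=
        le_antisymm hdeg (le_natDegree_of_ne_zero htop)
      have hr0 : r ≠ 0 := by rintro rfl; simp at h0
      obtain ⟨α, hα⟩ := Complex.exists_root (f := r)
        (natDegree_pos_iff_degree_pos.1 (by omega))
      have hα0 : α ≠ 0 := by
        rintro rfl
        exact h0 (by rw [coeff_zero_eq_eval_zero]; exact hα)
      -- positivity excludes roots on the circle, so `α` and `1 / ᾱ` are distinct
      have hα1 : ‖α‖ ≠ 1 := by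
        intro h
        obtain ⟨t, ht, h'⟩ := hpos α h
        rw [hα.eq_zero] at h'
        exact mul_ne_zero (pow_ne_zero _ hα0) (by exact_mod_cast ht.ne') h'.symm
      have hs0 : star α ≠ 0 := by simpa using hα0
      have hβ : r.IsRoot (star α)⁻¹ := by
        have _ : Invertible (star α) := invertibleOfNonzero hs0
        have h := eval₂_reflect_mul_pow (RingHom.id ℂ) (star α) (2 * (K + 1))
          (r.map (starRingEnd ℂ)) (natDegree_map_le.trans hdeg)
        rw [← eval, ← eval, eval_map_conj, invOf_eq_inv, hrec, hα.eq_zero, star_zero] at h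
        exact (mul_eq_zero.1 h).resolve_right (pow_ne_zero _ hs0)
      have hne : (star α)⁻¹ ≠ α := by
        intro h
        have h' : ‖α‖⁻¹ = ‖α‖ := by
          simpa using congrArg norm h
        have hpos' : 0 < ‖α‖ := norm_pos_iff.2 hα0
        have : ‖α‖ * ‖α‖ = 1 := by
          conv_lhs => rw [← h', h']
          conv_lhs => enter [1]; rw [← h']
          exact inv_mul_cancel₀ hpos'.ne'
        exact hα1 (by nlinarith)
      obtain ⟨r₁, hr₁⟩ := dvd_iff_isRoot.2 hα
      have hβ₁ : r₁.IsRoot (star α)⁻¹ := by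
        have h := hβ.eq_zero
        rw [hr₁, eval_mul, eval_sub, eval_X, eval_C] at h
        exact (mul_eq_zero.1 h).resolve_left (sub_ne_zero.2 hne)
      obtain ⟨r₂, hr₂⟩ := dvd_iff_isRoot.2 hβ₁
      have hr₂0 : r₂ ≠ 0 := by rintro rfl; simp [hr₂] at hr₁; exact hr0 hr₁
      have hd : (C (-(star α)⁻¹) * r₂).natDegree ≤ 2 * K := by
        refine (natDegree_C_mul_le _ _).trans ?_
        rw [hr₁, hr₂, natDegree_mul (X_sub_C_ne_zero _) (mul_ne_zero (X_sub_C_ne_zero _) hr₂0),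
          natDegree_mul (X_sub_C_ne_zero _) hr₂0, natDegree_X_sub_C, natDegree_X_sub_C] at hnat
        omega
      have hev (z : ℂ) (hz : ‖z‖ = 1) : r.eval z
          = z * ((‖z - α‖ ^ 2 : ℝ) : ℂ) * (C (-(star α)⁻¹) * r₂).eval z := by
        have h1 : ((‖z - α‖ ^ 2 : ℝ) : ℂ) = (z - α) * (z⁻¹ - star α) := by
          rw [← conj_eq_inv_of_norm_eq_one hz, ← star_sub, Complex.star_def, Complex.mul_conj']
          push_cast; rfl
        have := hz0 z hz
        rw [h1, hr₁, hr₂]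
        simp only [eval_mul, eval_sub, eval_X, eval_C]
        field_simp
        ring
      have hzα (z : ℂ) (hz : ‖z‖ = 1) : 0 < ‖z - α‖ ^ 2 := by
        have : z - α ≠ 0 := by
          intro h
          exact hα1 (by rw [← sub_eq_zero.1 h, hz])
        positivity
      obtain ⟨q, hq, hqz⟩ := ih _ hd fun z hz => by
        obtain ⟨t, ht, h⟩ := hpos z hz
        have hp := hzα z hz
        refine ⟨t / ‖z - α‖ ^ 2, div_pos ht hp, ?_⟩
        have hp' : ((‖z - α‖ ^ 2 : ℝ) : ℂ) ≠ 0 := by exact_mod_cast hp.ne'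
        refine mul_left_cancel₀ (mul_ne_zero (hz0 z hz) hp') ?_
        rw [← hev z hz, h, Complex.ofReal_div]
        field_simp
        ring
      refine ⟨(X - C α) * q, natDegree_mul_le.trans ?_, fun z hz => ?_⟩
      · rw [natDegree_X_sub_C]; omega
      · rw [hev z hz, hqz z hz, eval_mul, norm_mul, eval_sub, eval_X, eval_C]
        push_cast; ring

/-- A polynomial bounded by `1` on the unit circle is one half of a polynomial unit vector. -/
lemma exists_complementary {K : ℕ} {p : ℂ[X]} (hp : p.natDegree ≤ K)
    (hlt : ∀ z : ℂ, ‖z‖ = 1 → ‖p.eval z‖ < 1) :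
    ∃ q : ℂ[X], q.natDegree ≤ K ∧
      ∀ z : ℂ, ‖z‖ = 1 → ‖p.eval z‖ ^ 2 + ‖q.eval z‖ ^ 2 = 1 := by
  have hev (z : ℂ) (hz : ‖z‖ = 1) : (X ^ K - p * reflect K (p.map (starRingEnd ℂ))).eval z
      = z ^ K * ((1 - ‖p.eval z‖ ^ 2 : ℝ) : ℂ) := by
    rw [eval_sub, eval_mul, eval_reflect_conj hp hz, eval_pow, eval_X]
    have := Complex.mul_conj' (p.eval z)
    push_cast
    rw [← this, Complex.star_def]
    ring
  obtain ⟨q, hq, hqz⟩ := fejer_riesz K (X ^ K - p * reflect K (p.map (starRingEnd ℂ)))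
    (by
      refine (natDegree_sub_le _ _).trans (max_le ((natDegree_X_pow_le _).trans (by omega))
        (natDegree_mul_le.trans ?_))
      have h := natDegree_reflect_le (N := K) (p := p.map (starRingEnd ℂ))
      have h' : (p.map (starRingEnd ℂ)).natDegree ≤ K := natDegree_map_le.trans hp
      have := h.trans (max_le le_rfl h')
      omega)
    fun z hz => ⟨_, by have := hlt z hz; nlinarith [norm_nonneg (p.eval z)], hev z hz⟩
  refine ⟨q, hq, fun z hz => ?_⟩
  have hz0 : z ≠ 0 := by rintro rfl; simp at hz
  have h := mul_left_cancel₀ (pow_ne_zero K hz0) ((hev z hz).symm.trans (hqz z hz))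
  have h' : 1 - ‖p.eval z‖ ^ 2 = ‖q.eval z‖ ^ 2 := by exact_mod_cast h
  linarith

/-! ### Quantum signal processing -/

/-- Orthogonal vectors `(a, b)` and `(c, d)` of `ℂ²` are rotated onto the second and the first
coordinate axis by some element of `SU(2)`. -/
lemma exists_rotation {a b c d : ℂ} (h : a * star c + b * star d = 0) :
    ∃ u v : ℂ, ‖u‖ ^ 2 + ‖v‖ ^ 2 = 1 ∧ star u * a + star v * b = 0 ∧ -v * c + u * d = 0 := by
  have key (u v : ℂ) (h0 : ¬(u = 0 ∧ v = 0)) (h1 : star u * a + star v * b = 0)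
      (h2 : -v * c + u * d = 0) :
      ∃ u v : ℂ, ‖u‖ ^ 2 + ‖v‖ ^ 2 = 1 ∧ star u * a + star v * b = 0 ∧ -v * c + u * d = 0 := by
    have hn : 0 < ‖u‖ ^ 2 + ‖v‖ ^ 2 := by
      by_contra hn
      have h1 := sq_nonneg ‖u‖
      have h2 := sq_nonneg ‖v‖
      exact h0 ⟨by simpa using (by linarith : ‖u‖ ^ 2 = 0),
        by simpa using (by linarith : ‖v‖ ^ 2 = 0)⟩
    set n : ℝ := Real.sqrt (‖u‖ ^ 2 + ‖v‖ ^ 2) with hnd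
    have hn2 : n ^ 2 = ‖u‖ ^ 2 + ‖v‖ ^ 2 := Real.sq_sqrt hn.le
    have hn0 : n ≠ 0 := (Real.sqrt_pos.2 hn).ne'
    refine ⟨u / n, v / n, ?_, ?_, ?_⟩
    · rw [norm_div, norm_div, Complex.norm_real, div_pow, div_pow, Real.norm_eq_abs, sq_abs,
        ← add_div, hn2, div_self hn.ne']
    · have hn : star (n : ℂ) = n := Complex.conj_ofReal n
      rw [star_div₀, star_div₀, hn]
      linear_combination h1 / n
    · linear_combination h2 / n
  by_cases hab : a = 0 ∧ b = 0
  · by_cases hcd : c = 0 ∧ d = 0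
    · exact key 1 0 (by simp) (by simp [hab]) (by simp [hcd])
    · exact key c d hcd (by simp [hab]) (by ring)
  · refine key (-star b) (star a) (by simpa [and_comm] using hab) (by simp; ring) ?_
    have := congrArg star h
    simp only [star_add, star_mul', star_star, star_zero] at this
    linear_combination -this

/-- Completeness of **quantum signal processing**: every polynomial unit vector `(p, q)` of degree
`K` is the first column of a product of `K` unary gates. The lowest and the highest coefficient
vectors of `(p, q)` are orthogonal, so a rotation makes `p` divisible by `X` and lowers the degree
of `q`, and then a gate can be split off. -/
theorem realizable_quat_of_unit_vector {K : ℕ} {p q : ℂ[X]} (hp : p.natDegree ≤ K)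
    (hq : q.natDegree ≤ K)
    (h : ∀ z : ℂ, ‖z‖ = 1 → ‖p.eval z‖ ^ 2 + ‖q.eval z‖ ^ 2 = 1) :
    Realizable (fun _ : Unit => Pauli.Z.gen) (List.replicate K 0)
      (fun x => quat (Complex.exp (-(Complex.I * K * x / 2)) * p.eval (Complex.exp (Complex.I * x)))
        (Complex.exp (-(Complex.I * K * x / 2)) * q.eval (Complex.exp (Complex.I * x)))) := by
  induction K generalizing p q with
  | zero =>
    rw [eq_C_of_natDegree_le_zero hp, eq_C_of_natDegree_le_zero hq]
    have h1 := h 1 (by simp)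
    rw [eq_C_of_natDegree_le_zero hp, eq_C_of_natDegree_le_zero hq] at h1
    simp only [eval_C] at h1
    exact (Realizable.const ⟨_, quat_mem_unitaryGroup h1⟩).of_eq fun x => by simp
  | succ K ih =>
    have horth : p.coeff 0 * star (p.coeff (K + 1)) + q.coeff 0 * star (q.coeff (K + 1)) = 0 := by
      have hpoly : p * reflect (K + 1) (p.map (starRingEnd ℂ))
          + q * reflect (K + 1) (q.map (starRingEnd ℂ)) = X ^ (K + 1) := by
        refine eq_of_eval_circle fun z hz => ?_
        rw [eval_add, eval_mul, eval_mul, eval_reflect_conj hp hz, eval_reflect_conj hq hz,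
          eval_pow, eval_X]
        have h1 := Complex.mul_conj' (p.eval z)
        have h2 := Complex.mul_conj' (q.eval z)
        have h3 : ((‖p.eval z‖ : ℂ) ^ 2 + (‖q.eval z‖ : ℂ) ^ 2) = 1 := by exact_mod_cast h z hz
        rw [← h1, ← h2] at h3
        rw [Complex.star_def]
        linear_combination z ^ (K + 1) * h3
      have h0 := congrArg (coeff · 0) hpoly
      simpa [mul_coeff_zero, coeff_reflect, revAt_le] using h0
    obtain ⟨u, v, huv, h1, h2⟩ := exists_rotation horth
    have huv' : u * star u + v * star v = 1 := by
      rw [Complex.star_def, Complex.mul_conj', Complex.mul_conj']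
      exact_mod_cast huv
    set p' := C (star u) * p + C (star v) * q with hp'
    set q' := C (-v) * p + C u * q with hq'
    have hp'0 : p'.coeff 0 = 0 := by simpa [hp'] using h1
    have hp'd : p'.natDegree ≤ K + 1 := natDegree_add_le_of_degree_le
      ((natDegree_C_mul_le _ _).trans hp) ((natDegree_C_mul_le _ _).trans hq)
    have hq'd : q'.natDegree ≤ K := natDegree_le_of_coeff_eq_zero
      (natDegree_add_le_of_degree_le
        ((natDegree_C_mul_le _ _).trans hp) ((natDegree_C_mul_le _ _).trans hq))
      (by simpa [hq'] using h2)
    have hev (z : ℂ) : z * p'.divX.eval z = star u * p.eval z + star v * q.eval z := by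
      have : p' = p'.divX * X := by
        conv_lhs => rw [← divX_mul_X_add p', hp'0, C_0, add_zero]
      have h := congrArg (eval z) this
      rw [eval_mul, eval_X] at h
      rw [mul_comm, ← h, hp']
      simp
    have hev' (z : ℂ) : q'.eval z = -v * p.eval z + u * q.eval z := by simp [hq']
    have hnorm (z : ℂ) (hz : ‖z‖ = 1) : ‖p'.divX.eval z‖ ^ 2 + ‖q'.eval z‖ ^ 2 = 1 := by
      have e1 : ‖p'.divX.eval z‖ = ‖star u * p.eval z + star v * q.eval z‖ := by
        rw [← hev, norm_mul, hz, one_mul]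
      have e2 := h z hz
      have f1 := Complex.mul_conj' (p.eval z)
      have f2 := Complex.mul_conj' (q.eval z)
      have f3 := Complex.mul_conj' (star u * p.eval z + star v * q.eval z)
      have f4 := Complex.mul_conj' (-v * p.eval z + u * q.eval z)
      rw [e1, hev']
      have e2' : ((‖p.eval z‖ : ℂ) ^ 2 + (‖q.eval z‖ : ℂ) ^ 2) = 1 := by exact_mod_cast e2
      have : ((‖star u * p.eval z + star v * q.eval z‖ : ℂ) ^ 2
          + (‖-v * p.eval z + u * q.eval z‖ : ℂ) ^ 2) = 1 := by
        rw [← f3, ← f4]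
        rw [← f1, ← f2] at e2'
        simp only [map_add, map_mul, map_neg, Complex.star_def, Complex.conj_conj] at huv' ⊢
        linear_combination huv' + (u * (starRingEnd ℂ) u + v * (starRingEnd ℂ) v) * (e2')
      exact_mod_cast this
    have hF := ih (p := p'.divX) (q := q')
      (by rw [natDegree_divX_eq_natDegree_tsub_one]; omega) hq'd hnorm
    have hW := hF.gate ⟨quat u v, quat_mem_unitaryGroup huv⟩ () 0
    refine hW.of_eq fun x => ?_
    have hE : Complex.exp (Complex.I * ((3 ^ 0 : ℝ) : ℂ) * x / 2)
        * Complex.exp (-(Complex.I * K * x / 2))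
          = Complex.exp (-(Complex.I * (K + 1 : ℕ) * x / 2)) * Complex.exp (Complex.I * x) := by
      rw [← Complex.exp_add, ← Complex.exp_add]; congr 1; push_cast; ring
    have hE' : star (Complex.exp (Complex.I * ((3 ^ 0 : ℝ) : ℂ) * x / 2))
        * Complex.exp (-(Complex.I * K * x / 2))
          = Complex.exp (-(Complex.I * (K + 1 : ℕ) * x / 2)) := by
      rw [Complex.star_def, ← Complex.exp_conj, ← Complex.exp_add]; congr 1
      simp [map_ofNat]; ring
    have hz := hev (Complex.exp (Complex.I * x))
    rw [encGate_Z_eq_quat, Matrix.mul_assoc, quat_mul, quat_mul]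
    simp only [star_zero, zero_mul, sub_zero, zero_add, ← mul_assoc, hE, hE', hev']
    congr 1
    · linear_combination Complex.exp (-(Complex.I * (K + 1 : ℕ) * x / 2)) * (u * hz
        + p.eval (Complex.exp (Complex.I * x)) * huv')
    · linear_combination Complex.exp (-(Complex.I * (K + 1 : ℕ) * x / 2)) * (v * hz
        + q.eval (Complex.exp (Complex.I * x)) * huv')

/-! ### Bounded trigonometric approximation of a fractional frequency -/

/-- The Taylor coefficients of `s ↦ exp (i b arcsin s)` at `0`. -/
noncomputable def arcsinCoeff (b : ℝ) : ℕ → ℂ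
  | 0 => 1
  | 1 => Complex.I * b
  | j + 2 => (((j : ℝ) ^ 2 - b ^ 2) / ((j + 1) * (j + 2)) : ℝ) * arcsinCoeff b j

/-- The Taylor polynomials of `s ↦ exp (i b arcsin s)`. -/
noncomputable def arcsinPoly (b : ℝ) (n : ℕ) : ℂ[X] :=
  ∑ j ∈ Finset.range n, C (arcsinCoeff b j) * X ^ j

lemma eval_arcsinPoly (b : ℝ) (n : ℕ) (s : ℂ) :
    (arcsinPoly b n).eval s = ∑ j ∈ Finset.range n, arcsinCoeff b j * s ^ j := by
  simp [arcsinPoly, eval_finsetSum]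

/-- The sequence `j |a_j|` decreases by at least `|a_{j+2}|`, which makes the sum of the `|a_j|`
telescope. -/
lemma norm_arcsinCoeff_add_two_le {b : ℝ} (hb : |b| ≤ 1 / 2) {j : ℕ} (hj : 1 ≤ j) :
    ‖arcsinCoeff b (j + 2)‖ + (j + 2) * ‖arcsinCoeff b (j + 2)‖ ≤ j * ‖arcsinCoeff b j‖ := by
  have hj' : (1 : ℝ) ≤ j := by exact_mod_cast hj
  have hb2 : b ^ 2 ≤ 1 / 4 := by
    rw [← sq_abs]; nlinarith [abs_nonneg b]
  have h : (j + 1) * (j + 2) * ‖arcsinCoeff b (j + 2)‖ ≤ j ^ 2 * ‖arcsinCoeff b j‖ := by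
    rw [arcsinCoeff, norm_mul, Complex.norm_real, Real.norm_eq_abs, abs_div,
      abs_of_nonneg (by nlinarith : (0 : ℝ) ≤ (j : ℝ) ^ 2 - b ^ 2),
      abs_of_pos (by positivity : (0 : ℝ) < (j + 1) * (j + 2))]
    have : ((j : ℝ) + 1) * (j + 2) * (((j : ℝ) ^ 2 - b ^ 2) / ((j + 1) * (j + 2))
        * ‖arcsinCoeff b j‖) = ((j : ℝ) ^ 2 - b ^ 2) * ‖arcsinCoeff b j‖ := by
      field_simp
    rw [this]
    exact mul_le_mul_of_nonneg_right (by nlinarith [sq_nonneg b]) (norm_nonneg _)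
  have h' : (j : ℝ) * (‖arcsinCoeff b (j + 2)‖ + (j + 2) * ‖arcsinCoeff b (j + 2)‖)
      ≤ j * (j * ‖arcsinCoeff b j‖) := by
    nlinarith [norm_nonneg (arcsinCoeff b (j + 2))]
  exact le_of_mul_le_mul_left h' (by linarith)

lemma arcsinCoeff_pair_le {b : ℝ} (hb : |b| ≤ 1 / 2) (m : ℕ) :
    ((m + 1 : ℕ) : ℝ) * ‖arcsinCoeff b (m + 1)‖ + ((m + 2 : ℕ) : ℝ) * ‖arcsinCoeff b (m + 2)‖
      ≤ 1 := by
  induction m with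
  | zero =>
    have h1 : ‖arcsinCoeff b 1‖ = |b| := by simp [arcsinCoeff]
    have h2 : ‖arcsinCoeff b 2‖ = |b| ^ 2 / 2 := by
      simp [arcsinCoeff]
    simp only [Nat.zero_add]
    rw [h1, h2]
    push_cast
    nlinarith [abs_nonneg b]
  | succ m ih =>
    have h := norm_arcsinCoeff_add_two_le hb (j := m + 1) (by omega)
    have := norm_nonneg (arcsinCoeff b (m + 3))
    push_cast at ih h ⊢
    ring_nf at ih h this ⊢
    linarith

lemma sum_norm_arcsinCoeff_le {b : ℝ} (hb : |b| ≤ 1 / 2) (m M : ℕ) :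
    ∑ j ∈ Finset.range M, ‖arcsinCoeff b (m + 3 + j)‖ ≤ 1 := by
  have key : ∑ j ∈ Finset.range M, ‖arcsinCoeff b (m + 3 + j)‖
      + (((m + M + 1 : ℕ) : ℝ) * ‖arcsinCoeff b (m + M + 1)‖
        + ((m + M + 2 : ℕ) : ℝ) * ‖arcsinCoeff b (m + M + 2)‖)
      ≤ ((m + 1 : ℕ) : ℝ) * ‖arcsinCoeff b (m + 1)‖
        + ((m + 2 : ℕ) : ℝ) * ‖arcsinCoeff b (m + 2)‖ := by
    induction M with
    | zero => simp
    | succ M ih =>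
      have h := norm_arcsinCoeff_add_two_le hb (j := m + M + 1) (by omega)
      rw [Finset.sum_range_succ]
      have e1 : m + 3 + M = m + M + 1 + 2 := by ring
      have e2 : m + (M + 1) + 1 = m + M + 2 := by ring
      have e3 : m + (M + 1) + 2 = m + M + 1 + 2 := by ring
      rw [e1, e2, e3]
      push_cast at ih h ⊢
      linarith
  have h1 := arcsinCoeff_pair_le hb m
  have h2 : 0 ≤ ((m + M + 1 : ℕ) : ℝ) * ‖arcsinCoeff b (m + M + 1)‖
        + ((m + M + 2 : ℕ) : ℝ) * ‖arcsinCoeff b (m + M + 2)‖ := by positivity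
  linarith

lemma norm_arcsinPoly_sub_le {b : ℝ} (hb : |b| ≤ 1 / 2) {n : ℕ} (hn : 3 ≤ n) (M : ℕ) {s : ℝ}
    (hs : |s| ≤ 1) :
    ‖(arcsinPoly b n).eval (s : ℂ) - (arcsinPoly b (n + M)).eval (s : ℂ)‖ ≤ |s| ^ n := by
  obtain ⟨m, rfl⟩ := Nat.exists_eq_add_of_le' hn
  rw [eval_arcsinPoly, eval_arcsinPoly, Finset.sum_range_add _ (m + 3) M, sub_add_cancel_left,
    norm_neg]
  calc ‖∑ j ∈ Finset.range M, arcsinCoeff b (m + 3 + j) * (s : ℂ) ^ (m + 3 + j)‖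
      ≤ ∑ j ∈ Finset.range M, ‖arcsinCoeff b (m + 3 + j)‖ * |s| ^ (m + 3) := by
        refine norm_sum_le_of_le _ fun j _ => ?_
        rw [norm_mul, norm_pow, Complex.norm_real, Real.norm_eq_abs]
        exact mul_le_mul_of_nonneg_left
          (pow_le_pow_of_le_one (abs_nonneg s) hs (Nat.le_add_right _ _)) (norm_nonneg _)
    _ ≤ |s| ^ (m + 3) := by
        rw [← Finset.sum_mul]
        exact mul_le_of_le_one_left (by positivity) (sum_norm_arcsinCoeff_le hb m M)

/-- A perturbation bound for `D'' + b² D = r` with zero initial values: the second-order operator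
factors into `d/dt + i b` and `d/dt - i b`, each of which is integrated with an exponential factor
of modulus `1`. -/
lemma norm_le_of_oscillator {b y R : ℝ} {D D₁ r : ℝ → ℂ} (hD : ∀ t, HasDerivAt D (D₁ t) t)
    (hD₁ : ∀ t, HasDerivAt D₁ (-(b : ℂ) ^ 2 * D t + r t) t) (h0 : D 0 = 0) (h1 : D₁ 0 = 0)
    (hr : ∀ t, |t| ≤ |y| → ‖r t‖ ≤ R) : ‖D y‖ ≤ R * |y| * |y| := by
  have hexp (c : ℂ) (t : ℝ) : HasDerivAt (fun t : ℝ => Complex.exp (c * t))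
      (Complex.exp (c * t) * c) t := by
    have h := ((Complex.ofRealCLM.hasDerivAt (x := t)).const_mul c).cexp
    simpa using h
  have hnorm (c t : ℝ) : ‖Complex.exp (Complex.I * c * t)‖ = 1 := by
    rw [mul_assoc, ← Complex.ofReal_mul]; exact norm_exp_I_mul _
  have hnorm' (t : ℝ) : ‖Complex.exp (-(Complex.I * b) * t)‖ = 1 := by
    have := hnorm (-b) t
    simpa using this
  have hmem (t : ℝ) : t ∈ Set.Icc (-|y|) |y| ↔ |t| ≤ |y| := by rw [Set.mem_Icc, abs_le]
  have hR : 0 ≤ R := (norm_nonneg _).trans (hr 0 (by simp))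
  have hv (t : ℝ) (ht : |t| ≤ |y|) : ‖D₁ t - Complex.I * b * D t‖ ≤ R * |y| := by
    have hder (t : ℝ) : HasDerivAt
        (fun t => (D₁ t - Complex.I * b * D t) * Complex.exp (Complex.I * b * t))
        (r t * Complex.exp (Complex.I * b * t)) t := by
      refine (((hD₁ t).sub ((hD t).const_mul (Complex.I * b))).mul
        (hexp (Complex.I * b) t)).congr_deriv ?_
      simp only [Pi.sub_apply]
      linear_combination (-(b : ℂ) ^ 2 * D t * Complex.exp (Complex.I * b * t)) * Complex.I_sq
    have := (convex_Icc (-|y|) |y|).norm_image_sub_le_of_norm_hasDerivWithin_le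
      (fun t _ => (hder t).hasDerivWithinAt) (C := R)
      (fun t ht => by rw [norm_mul, hnorm, mul_one]; exact hr t ((hmem t).1 ht))
      ((hmem 0).2 (by simp)) ((hmem t).2 ht)
    simp only [h0, h1, mul_zero, sub_zero, zero_mul, norm_mul, hnorm, mul_one, Real.norm_eq_abs]
      at this
    exact this.trans (mul_le_mul_of_nonneg_left ht hR)
  have hder (t : ℝ) : HasDerivAt (fun t => D t * Complex.exp (-(Complex.I * b) * t))
      ((D₁ t - Complex.I * b * D t) * Complex.exp (-(Complex.I * b) * t)) t := by
    refine ((hD t).mul (hexp (-(Complex.I * b)) t)).congr_deriv ?_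
    ring
  have := (convex_Icc (-|y|) |y|).norm_image_sub_le_of_norm_hasDerivWithin_le
    (fun t _ => (hder t).hasDerivWithinAt) (C := R * |y|)
    (fun t ht => by rw [norm_mul, hnorm', mul_one]; exact hv t ((hmem t).1 ht))
    ((hmem 0).2 (by simp)) ((hmem y).2 le_rfl)
  simpa only [h0, zero_mul, sub_zero, norm_mul, hnorm', mul_one, Real.norm_eq_abs] using this

/-- The derivative of `y ↦ arcsinPoly b n (sin y)`. -/
noncomputable def arcsinDeriv (b : ℝ) (n : ℕ) (y : ℝ) : ℂ :=
  ∑ j ∈ Finset.range n, arcsinCoeff b j * ((j * Real.sin y ^ (j - 1) * Real.cos y : ℝ) : ℂ)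

lemma hasDerivAt_arcsinPoly_sin (b : ℝ) (n : ℕ) (y : ℝ) :
    HasDerivAt (fun y : ℝ => (arcsinPoly b n).eval (Real.sin y : ℂ)) (arcsinDeriv b n y) y := by
  simp only [eval_arcsinPoly, arcsinDeriv]
  refine HasDerivAt.fun_sum fun j _ => ?_
  have := (((Real.hasDerivAt_sin y).pow j).ofReal_comp).const_mul (arcsinCoeff b j)
  simpa using this

/-- `arcsinPoly b n (sin y)` solves the equation `g'' + b² g = 0` of `exp (i b y)` up to the last
two terms of the series. -/
lemma hasDerivAt_arcsinDeriv (b : ℝ) (n : ℕ) (y : ℝ) :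
    HasDerivAt (arcsinDeriv b (n + 2)) (-(b : ℂ) ^ 2 * (arcsinPoly b (n + 2)).eval (Real.sin y : ℂ)
      + (-(((n : ℝ) ^ 2 - b ^ 2 : ℝ) * arcsinCoeff b n * (Real.sin y : ℂ) ^ n)
        - (((n + 1 : ℕ) : ℝ) ^ 2 - b ^ 2 : ℝ) * arcsinCoeff b (n + 1)
          * (Real.sin y : ℂ) ^ (n + 1))) y := by
  have hterm (j : ℕ) : HasDerivAt
      (fun y => arcsinCoeff b j * ((j * Real.sin y ^ (j - 1) * Real.cos y : ℝ) : ℂ))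
      (arcsinCoeff b j * ((j * (j - 1) * Real.sin y ^ (j - 2) - (j : ℝ) ^ 2 * Real.sin y ^ j : ℝ)
        : ℂ)) y := by
    have h := ((((Real.hasDerivAt_sin y).pow (j - 1)).const_mul (j : ℝ)).mul
      (Real.hasDerivAt_cos y)).ofReal_comp.const_mul (arcsinCoeff b j)
    refine h.congr_deriv ?_
    congr 2
    rcases j with _ | _ | j
    · simp
    · simp
    · have hc := Real.sin_sq_add_cos_sq y
      simp only [show j + 1 + 1 - 1 = j + 1 by omega, show j + 1 + 1 - 2 = j by omega,
        show j + 1 - 1 = j by omega, Pi.pow_apply]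
      push_cast
      linear_combination ((j + 1 + 1) * (j + 1) * Real.sin y ^ j) * hc
  have hsum : HasDerivAt (arcsinDeriv b (n + 2)) (∑ j ∈ Finset.range (n + 2), arcsinCoeff b j
      * ((j * (j - 1) * Real.sin y ^ (j - 2) - (j : ℝ) ^ 2 * Real.sin y ^ j : ℝ) : ℂ)) y :=
    HasDerivAt.fun_sum fun j _ => hterm j
  refine hsum.congr_deriv (Eq.symm ?_)
  rw [eval_arcsinPoly]
  clear hsum hterm
  induction n with
  | zero =>
    simp [Finset.sum_range_succ, arcsinCoeff]
    ring
  | succ n ih =>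
    rw [Finset.sum_range_succ, Finset.sum_range_succ _ (n + 2), ← ih, arcsinCoeff]
    have h1 : ((n : ℂ) + 1) ≠ 0 := by exact_mod_cast n.succ_ne_zero
    have h2 : ((n : ℂ) + 2) ≠ 0 := by exact_mod_cast (n + 1).succ_ne_zero
    push_cast
    field_simp
    ring

lemma tendsto_arcsinPoly {b : ℝ} (hb : |b| ≤ 1 / 2) {y : ℝ} (hy : |y| < Real.pi / 2) :
    Filter.Tendsto (fun n => (arcsinPoly b n).eval (Real.sin y : ℂ)) Filter.atTop
      (nhds (Complex.exp (Complex.I * b * y))) := by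
  set ρ := |Real.sin y| with hρ
  have hsin (t : ℝ) (ht : |t| ≤ |y|) : |Real.sin t| ≤ ρ := by
    rw [hρ, Real.abs_sin_eq_sin_abs_of_abs_le_pi (by linarith [Real.pi_pos]),
      Real.abs_sin_eq_sin_abs_of_abs_le_pi (by linarith [Real.pi_pos])]
    exact Real.sin_le_sin_of_le_of_le_pi_div_two (by linarith [abs_nonneg t, Real.pi_pos]) hy.le ht
  have hρ1 : ρ < 1 := by
    rw [hρ, Real.abs_sin_eq_sin_abs_of_abs_le_pi (by linarith [Real.pi_pos]), ← Real.sin_pi_div_two]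
    exact Real.sin_lt_sin_of_lt_of_le_pi_div_two (by linarith [abs_nonneg y, Real.pi_pos]) le_rfl hy
  have hρ0 : 0 ≤ ρ := abs_nonneg _
  have hcoeff (n : ℕ) : ‖((n + 1 : ℕ) : ℝ) ^ 2 - b ^ 2‖ * ‖arcsinCoeff b (n + 1)‖
      ≤ ((n + 1 : ℕ) : ℝ) := by
    have h1 := arcsinCoeff_pair_le hb n
    have hb2 : b ^ 2 ≤ 1 / 4 := by
      rw [← sq_abs]; nlinarith [abs_nonneg b]
    have hn : (1 : ℝ) ≤ ((n + 1 : ℕ) : ℝ) := by simp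
    rw [Real.norm_eq_abs, abs_of_nonneg (by nlinarith)]
    have h2 : 0 ≤ ((n + 2 : ℕ) : ℝ) * ‖arcsinCoeff b (n + 2)‖ := by positivity
    have h3 := norm_nonneg (arcsinCoeff b (n + 1))
    nlinarith [mul_nonneg (sq_nonneg b) h3]
  have hbound (n : ℕ) : ‖(arcsinPoly b (n + 3)).eval (Real.sin y : ℂ)
      - Complex.exp (Complex.I * b * y)‖
      ≤ (((n + 1 : ℕ) : ℝ) * ρ ^ (n + 1) + ((n + 2 : ℕ) : ℝ) * ρ ^ (n + 2)) * |y| * |y| := by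
    have hexp (t : ℝ) : HasDerivAt (fun t : ℝ => Complex.exp (Complex.I * b * t))
        (Complex.exp (Complex.I * b * t) * (Complex.I * b)) t := by
      simpa using ((Complex.ofRealCLM.hasDerivAt (x := t)).const_mul (Complex.I * b)).cexp
    refine norm_le_of_oscillator (b := b)
      (D := fun t => (arcsinPoly b (n + 3)).eval (Real.sin t : ℂ) - Complex.exp (Complex.I * b * t))
      (D₁ := fun t => arcsinDeriv b (n + 3) t - Complex.exp (Complex.I * b * t) * (Complex.I * b))
      (r := fun t => -(((n + 1 : ℕ) : ℝ) ^ 2 - b ^ 2 : ℝ) * arcsinCoeff b (n + 1)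
          * (Real.sin t : ℂ) ^ (n + 1)
        - (((n + 2 : ℕ) : ℝ) ^ 2 - b ^ 2 : ℝ) * arcsinCoeff b (n + 2)
          * (Real.sin t : ℂ) ^ (n + 2))
      (fun t => (hasDerivAt_arcsinPoly_sin b (n + 3) t).sub (hexp t)) (fun t => ?_) ?_ ?_ ?_
    · refine ((hasDerivAt_arcsinDeriv b (n + 1) t).sub
        ((hexp t).mul_const (Complex.I * b))).congr_deriv ?_
      linear_combination (-Complex.exp (Complex.I * b * t) * b ^ 2) * Complex.I_sq
    · simp [eval_arcsinPoly, Finset.sum_range_succ', arcsinCoeff]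
    · simp [arcsinDeriv, Finset.sum_range_succ', arcsinCoeff]
    · intro t ht
      refine (norm_sub_le _ _).trans (add_le_add ?_ ?_)
      · rw [norm_mul, norm_mul, norm_neg, norm_pow, Complex.norm_real, Complex.norm_real]
        exact mul_le_mul (hcoeff n) (pow_le_pow_left₀ (abs_nonneg _) (hsin t ht) _)
          (by positivity) (by positivity)
      · rw [norm_mul, norm_mul, norm_pow, Complex.norm_real, Complex.norm_real]
        exact mul_le_mul (hcoeff (n + 1)) (pow_le_pow_left₀ (abs_nonneg _) (hsin t ht) _)
          (by positivity) (by positivity)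
  have hlim : Filter.Tendsto (fun n : ℕ => (n : ℝ) * ρ ^ n) Filter.atTop (nhds 0) := by
    simpa using tendsto_self_mul_const_pow_of_lt_one hρ0 hρ1
  have hlim' := (((hlim.comp (Filter.tendsto_add_atTop_nat 1)).add
    (hlim.comp (Filter.tendsto_add_atTop_nat 2))).mul_const |y|).mul_const |y|
  rw [← Filter.tendsto_add_atTop_iff_nat 3, tendsto_iff_norm_sub_tendsto_zero]
  refine squeeze_zero (fun _ => norm_nonneg _) hbound ?_
  simpa using hlim'

/-- The remainder of the Taylor polynomial is the limit of the differences to later Taylor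
polynomials, whose coefficients have absolute sum at most `1`. -/
lemma norm_arcsinPoly_sub_exp_le {b : ℝ} (hb : |b| ≤ 1 / 2) {n : ℕ} (hn : 3 ≤ n) {y : ℝ}
    (hy : |y| < Real.pi / 2) :
    ‖(arcsinPoly b n).eval (Real.sin y : ℂ) - Complex.exp (Complex.I * b * y)‖
      ≤ |Real.sin y| ^ n := by
  have h : Filter.Tendsto (fun M => (arcsinPoly b (M + n)).eval (Real.sin y : ℂ)) Filter.atTop
      (nhds (Complex.exp (Complex.I * b * y))) :=
    (tendsto_arcsinPoly hb hy).comp (Filter.tendsto_add_atTop_nat n)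
  refine le_of_tendsto (tendsto_const_nhds.sub h).norm (Filter.Eventually.of_forall fun M => ?_)
  rw [add_comm M n]
  exact norm_arcsinPoly_sub_le hb hn M (Real.abs_sin_le_one y)

/-- The bound extends to the whole closed interval, of which the previous estimate covers the
interior. -/
lemma norm_arcsinPoly_le {b : ℝ} (hb : |b| ≤ 1 / 2) {n : ℕ} (hn : 3 ≤ n) {s : ℝ}
    (hs : s ∈ Set.Icc (-1 : ℝ) 1) : ‖(arcsinPoly b n).eval (s : ℂ)‖ ≤ 1 + |s| ^ n := by
  have hclosed : IsClosed {s : ℝ | ‖(arcsinPoly b n).eval (s : ℂ)‖ ≤ 1 + |s| ^ n} := by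
    refine isClosed_le ?_ (by fun_prop)
    exact ((arcsinPoly b n).continuous.comp Complex.continuous_ofReal).norm
  rw [← closure_Ioo (by norm_num)] at hs
  refine closure_minimal (fun s hs => ?_) hclosed hs
  have hy : |Real.arcsin s| < Real.pi / 2 := by
    rw [abs_lt]
    exact ⟨Real.neg_pi_div_two_lt_arcsin.2 hs.1, Real.arcsin_lt_pi_div_two.2 hs.2⟩
  have h := norm_arcsinPoly_sub_exp_le hb hn hy
  rw [Real.sin_arcsin hs.1.le hs.2.le] at h
  have h1 : ‖Complex.exp (Complex.I * b * Real.arcsin s)‖ = 1 := by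
    rw [mul_assoc, ← Complex.ofReal_mul]; exact norm_exp_I_mul _
  have := norm_le_norm_add_norm_sub' ((arcsinPoly b n).eval (s : ℂ))
    (Complex.exp (Complex.I * b * Real.arcsin s))
  rw [h1] at this
  show ‖(arcsinPoly b n).eval (s : ℂ)‖ ≤ 1 + |s| ^ n
  linarith

/-- A polynomial in `s = sin y`, bounded by `1` on `[-1, 1]`, that approximates `exp (i b y)`. The
damping factor `1 - s ^ n` compensates the excess `|s| ^ n` of the Taylor polynomial over the
bound `1`. -/
lemma exists_bounded_poly {b : ℝ} (hb : |b| ≤ 1 / 2) {n : ℕ} (hn : 3 ≤ n) (he : Even n) :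
    ∃ h : ℂ[X], h.natDegree ≤ 2 * n ∧ (∀ s ∈ Set.Icc (-1 : ℝ) 1, ‖h.eval (s : ℂ)‖ ≤ 1) ∧
      ∀ y : ℝ, |y| ≤ 1 / 2 →
        ‖h.eval (Real.sin y : ℂ) - Complex.exp (Complex.I * b * y)‖ ≤ 3 * (1 / 2) ^ n := by
  have hev (s : ℝ) : ((1 - X ^ n) * arcsinPoly b n : ℂ[X]).eval (s : ℂ)
      = ((1 - |s| ^ n : ℝ) : ℂ) * (arcsinPoly b n).eval (s : ℂ) := by
    rw [he.pow_abs]; simp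
  have hs1 (s : ℝ) (hs : s ∈ Set.Icc (-1 : ℝ) 1) : |s| ^ n ≤ 1 :=
    pow_le_one₀ (abs_nonneg s) (abs_le.2 hs)
  refine ⟨(1 - X ^ n) * arcsinPoly b n, ?_, fun s hs => ?_, fun y hy => ?_⟩
  · refine natDegree_mul_le.trans ?_
    have h1 : (1 - X ^ n : ℂ[X]).natDegree ≤ n :=
      (natDegree_sub_le _ _).trans (max_le (by simp) (natDegree_X_pow_le _))
    have h2 : (arcsinPoly b n).natDegree ≤ n :=
      natDegree_sum_le_of_forall_le _ _ fun j hj =>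
        (natDegree_C_mul_X_pow_le _ _).trans (Finset.mem_range.1 hj).le
    omega
  · have h := norm_arcsinPoly_le hb hn hs
    have h1 := hs1 s hs
    have h0 : 0 ≤ |s| ^ n := by positivity
    rw [hev, norm_mul, Complex.norm_real, Real.norm_eq_abs, abs_of_nonneg (by linarith)]
    nlinarith
  · have hmem : Real.sin y ∈ Set.Icc (-1 : ℝ) 1 := Real.sin_mem_Icc y
    have hsy : |Real.sin y| ^ n ≤ (1 / 2) ^ n :=
      pow_le_pow_left₀ (abs_nonneg _) (Real.abs_sin_le_abs.trans hy) n
    have h1 := norm_arcsinPoly_le hb hn hmem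
    have h2 := norm_arcsinPoly_sub_exp_le hb hn (y := y) (by linarith [Real.pi_gt_three])
    have h3 := hs1 _ hmem
    have h0 : 0 ≤ |Real.sin y| ^ n := by positivity
    rw [hev]
    have e : ((1 - |Real.sin y| ^ n : ℝ) : ℂ) * (arcsinPoly b n).eval (Real.sin y : ℂ)
        - Complex.exp (Complex.I * b * y)
        = ((arcsinPoly b n).eval (Real.sin y : ℂ) - Complex.exp (Complex.I * b * y))
          - ((|Real.sin y| ^ n : ℝ) : ℂ) * (arcsinPoly b n).eval (Real.sin y : ℂ) := by
      push_cast; ring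
    rw [e]
    refine (norm_sub_le _ _).trans ?_
    rw [norm_mul, Complex.norm_real, Real.norm_eq_abs, abs_of_nonneg h0]
    nlinarith

/-- A polynomial of degree `M` in `sin (x - 1/2)` is a trigonometric polynomial of degree `M`. -/
lemma exists_poly_sin (h : ℂ[X]) {M : ℕ} (hM : h.natDegree ≤ M) :
    ∃ p : ℂ[X], p.natDegree ≤ 2 * M ∧ ∀ x : ℝ,
      p.eval (Complex.exp (Complex.I * x))
        = Complex.exp (Complex.I * x) ^ M * h.eval (Real.sin (x - 1 / 2) : ℂ) := by
  set c := Complex.exp (-(Complex.I / 2)) with hc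
  set σ : ℂ[X] := C (c / (2 * Complex.I)) * X ^ 2 - C (c⁻¹ / (2 * Complex.I)) with hσ
  have hσd : σ.natDegree ≤ 2 := (natDegree_sub_le _ _).trans
    (max_le (natDegree_C_mul_X_pow_le _ _) (by simp))
  have hσx (x : ℝ) : σ.eval (Complex.exp (Complex.I * x))
      = Complex.exp (Complex.I * x) * (Real.sin (x - 1 / 2) : ℂ) := by
    have h1 : Complex.exp (((x : ℂ) - 1 / 2) * Complex.I) = Complex.exp (Complex.I * x) * c := by
      rw [hc, ← Complex.exp_add]; congr 1; ring
    have h2 : Complex.exp (-((x : ℂ) - 1 / 2) * Complex.I)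
        = (Complex.exp (Complex.I * x))⁻¹ * c⁻¹ := by
      rw [hc, ← Complex.exp_neg, ← Complex.exp_neg, ← Complex.exp_add]; congr 1; ring
    have hI := Complex.I_mul_I
    have hI0 := Complex.I_ne_zero
    have he := Complex.exp_ne_zero (Complex.I * x)
    have hc0 : c ≠ 0 := Complex.exp_ne_zero _
    rw [Complex.ofReal_sin, Complex.sin]
    push_cast
    rw [h1, h2, hσ]
    simp only [eval_sub, eval_mul, eval_C, eval_pow, eval_X]
    field_simp
    linear_combination (c ^ 2 * Complex.exp (Complex.I * x) ^ 2 - 1) * Complex.I_sq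
  refine ⟨∑ j ∈ Finset.range (M + 1), C (h.coeff j) * (σ ^ j * X ^ (M - j)), ?_, fun x => ?_⟩
  · refine natDegree_sum_le_of_forall_le _ _ fun j hj => (natDegree_C_mul_le _ _).trans ?_
    have h1 := natDegree_pow_le_of_le j hσd
    have h2 : (X ^ (M - j) : ℂ[X]).natDegree ≤ M - j := natDegree_X_pow_le _
    have h3 : j ≤ M := Nat.lt_succ_iff.1 (Finset.mem_range.1 hj)
    refine natDegree_mul_le.trans ?_
    omega
  · rw [eval_finsetSum, eval_eq_sum_range' (Nat.lt_succ_of_le hM), Finset.mul_sum]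
    refine Finset.sum_congr rfl fun j hj => ?_
    have h3 : j ≤ M := Nat.lt_succ_iff.1 (Finset.mem_range.1 hj)
    simp only [eval_mul, eval_C, eval_pow, eval_X, hσx]
    rw [← Nat.sub_add_cancel h3, pow_add, Nat.add_sub_cancel, mul_pow]
    ring

/-- The gate with a fractional frequency is approximated by a number of unary gates that is linear
in the number `n` of correct binary digits. -/
lemma exists_approx_fraction {b : ℝ} (hb : |b| ≤ 1 / 2) {n : ℕ} (hn : 3 ≤ n) (he : Even n) :
    ∃ A B : ℝ → ℂ, Realizable (fun _ : Unit => Pauli.Z.gen) (List.replicate (4 * n) 0)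
        (fun x => quat (A x) (B x)) ∧
      ∀ x ∈ Set.Icc (0 : ℝ) 1,
        ‖A x - Complex.exp (Complex.I * b * x)‖ ^ 2 + ‖B x‖ ^ 2 ≤ 12 * (1 / 2) ^ n := by
  obtain ⟨h, hd, hle, happ⟩ := exists_bounded_poly hb hn he
  obtain ⟨p, hpd, hp⟩ := exists_poly_sin h hd
  set η : ℝ := (1 / 2) ^ n with hη
  have hη0 : 0 < η := by positivity
  have hη1 : η ≤ 1 / 8 := by
    have := pow_le_pow_of_le_one (by norm_num : (0 : ℝ) ≤ 1 / 2) (by norm_num) hn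
    rw [hη]; norm_num at this ⊢; exact this
  set c := Complex.exp (Complex.I * b / 2) with hc
  have hcn : ‖c‖ = 1 := by
    rw [hc, show Complex.I * (b : ℂ) / 2 = Complex.I * ((b / 2 : ℝ) : ℂ) by push_cast; ring]
    exact norm_exp_I_mul _
  have hnle (x : ℝ) : ‖h.eval (Real.sin (x - 1 / 2) : ℂ)‖ ≤ 1 := hle _ (Real.sin_mem_Icc _)
  -- the factor `1 - η` makes `p` strictly smaller than `1` on the circle
  have hPev (x : ℝ) : (C (((1 - η : ℝ) : ℂ) * c) * p).eval (Complex.exp (Complex.I * x))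
      = ((1 - η : ℝ) : ℂ) * c * (Complex.exp (Complex.I * x) ^ (2 * n)
        * h.eval (Real.sin (x - 1 / 2) : ℂ)) := by
    rw [eval_mul, eval_C, hp]
  obtain ⟨q, hq, hpq⟩ := exists_complementary (K := 4 * n) (p := C (((1 - η : ℝ) : ℂ) * c) * p)
    ((natDegree_C_mul_le _ _).trans (by omega)) (fun z hz => by
      have hz' : z = Complex.exp (Complex.I * z.arg) := by
        conv_lhs => rw [← Complex.norm_mul_exp_arg_mul_I z, hz]
        rw [mul_comm Complex.I]; simp
      rw [hz', hPev, norm_mul, norm_mul, norm_mul, norm_pow, norm_exp_I_mul, hcn,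
        Complex.norm_real, Real.norm_eq_abs, abs_of_nonneg (by linarith)]
      have := hnle z.arg
      have h0 := norm_nonneg (h.eval (Real.sin (z.arg - 1 / 2) : ℂ))
      simp only [mul_one, one_pow, one_mul]
      nlinarith)
  refine ⟨_, _, realizable_quat_of_unit_vector
    ((natDegree_C_mul_le _ _).trans (by omega)) hq hpq, fun x hx => ?_⟩
  have hP := hpq _ (norm_exp_I_mul x)
  have hph : ‖Complex.exp (-(Complex.I * (4 * n : ℕ) * x / 2))‖ = 1 := by
    rw [show -(Complex.I * ((4 * n : ℕ) : ℂ) * (x : ℂ) / 2)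
      = Complex.I * ((-((4 * n : ℕ) * x / 2) : ℝ) : ℂ) by push_cast; ring]
    exact norm_exp_I_mul _
  have hpp : Complex.exp (-(Complex.I * (4 * n : ℕ) * x / 2))
      * Complex.exp (Complex.I * x) ^ (2 * n) = 1 := by
    rw [← Complex.exp_nat_mul, ← Complex.exp_add, ← Complex.exp_zero]
    congr 1; push_cast; ring
  have hA : Complex.exp (-(Complex.I * (4 * n : ℕ) * x / 2))
      * (C (((1 - η : ℝ) : ℂ) * c) * p).eval (Complex.exp (Complex.I * x))
      = ((1 - η : ℝ) : ℂ) * c * h.eval (Real.sin (x - 1 / 2) : ℂ) := by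
    rw [hPev]
    linear_combination ((1 - η : ℝ) : ℂ) * c * h.eval (Real.sin (x - 1 / 2) : ℂ) * hpp
  have hce : c * Complex.exp (Complex.I * b * ((x - 1 / 2 : ℝ) : ℂ))
      = Complex.exp (Complex.I * b * x) := by
    rw [hc, ← Complex.exp_add]; congr 1; push_cast; ring
  have herr : ‖((1 - η : ℝ) : ℂ) * c * h.eval (Real.sin (x - 1 / 2) : ℂ)
      - Complex.exp (Complex.I * b * x)‖ ≤ 4 * η := by
    have h1 := happ (x - 1 / 2) (by rw [abs_le]; constructor <;> linarith [hx.1, hx.2])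
    have e : ((1 - η : ℝ) : ℂ) * c * h.eval (Real.sin (x - 1 / 2) : ℂ)
        - Complex.exp (Complex.I * b * x)
        = c * (h.eval (Real.sin (x - 1 / 2) : ℂ)
            - Complex.exp (Complex.I * b * ((x - 1 / 2 : ℝ) : ℂ)))
          - (η : ℂ) * (c * h.eval (Real.sin (x - 1 / 2) : ℂ)) := by
      rw [← hce]; push_cast; ring
    rw [e]
    refine (norm_sub_le _ _).trans ?_
    rw [norm_mul, norm_mul, norm_mul, hcn, Complex.norm_real, Real.norm_eq_abs,
      abs_of_pos hη0]
    nlinarith [hnle x]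
  have hexp : ‖Complex.exp (Complex.I * b * x)‖ = 1 := by
    rw [mul_assoc, ← Complex.ofReal_mul]; exact norm_exp_I_mul _
  have hPn : ‖(C (((1 - η : ℝ) : ℂ) * c) * p).eval (Complex.exp (Complex.I * x))‖
      = ‖((1 - η : ℝ) : ℂ) * c * h.eval (Real.sin (x - 1 / 2) : ℂ)‖ := by
    rw [← hA, norm_mul, hph, one_mul]
  rw [hPn] at hP
  rw [hA, norm_mul, hph, one_mul]
  -- `|A| ≥ 1 - μ` for `μ = |A - exp (i b x)|`, hence `|B|² ≤ 2 μ - μ²`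
  have htri := norm_sub_norm_le (Complex.exp (Complex.I * b * x))
    (((1 - η : ℝ) : ℂ) * c * h.eval (Real.sin (x - 1 / 2) : ℂ))
  rw [hexp, norm_sub_rev] at htri
  set μ := ‖((1 - η : ℝ) : ℂ) * c * h.eval (Real.sin (x - 1 / 2) : ℂ)
      - Complex.exp (Complex.I * b * x)‖
  have hμ0 : 0 ≤ μ := norm_nonneg _
  have hμ1 : μ ≤ 1 := by linarith
  nlinarith

/-! ### One gate -/

/-- The exponents of the gates that replace one trainable gate: two gates for each power `3 ^ j`
with `j < m`, and `N` unary gates. -/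
def blockList (N : ℕ) : ℕ → List ℕ
  | 0 => List.replicate N 0
  | m + 1 => m :: m :: blockList N m

/-- The factor `exp (i t x)` with an integer `t` is split off exactly. Two gates for each power
`3 ^ j`, with bit flips in between, contribute `exp (i d 3 ^ j x)` with `d = 1`, `0` or `-1`;
hence the balanced ternary digits of `t` are the orientations. -/
lemma realizable_integer (N m : ℕ) {F : ℝ → Matrix (Fin 2) (Fin 2) ℂ}
    (hF : Realizable (fun _ : Unit => Pauli.Z.gen) (List.replicate N 0) F) (t : ℤ)
    (ht : 2 * |t| < 3 ^ m) :
    Realizable (fun _ : Unit => Pauli.Z.gen) (blockList N m)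
      (fun x => quat (Complex.exp (Complex.I * t * x)) 0 * F x) := by
  induction m generalizing t with
  | zero =>
    have : t = 0 := by
      have : |t| = 0 := by have := abs_nonneg t; omega
      simpa using this
    subst this
    refine hF.of_eq fun x => ?_
    ext i j
    fin_cases i <;> fin_cases j <;> simp [quat, Matrix.mul_apply, Fin.sum_univ_two]
  | succ m ih =>
    let flip : unitaryGroup (Fin 2) ℂ := ⟨quat 0 1, quat_mem_unitaryGroup (by simp)⟩
    let flip' : unitaryGroup (Fin 2) ℂ := ⟨quat 0 (-1), quat_mem_unitaryGroup (by simp)⟩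
    have ec (x : ℝ) : star (Complex.exp (Complex.I * ((3 ^ m : ℝ) : ℂ) * x / 2))
        = Complex.exp (-(Complex.I * 3 ^ m * x / 2)) := by
      rw [Complex.star_def, ← Complex.exp_conj]
      congr 1; simp [map_ofNat]; ring
    have hpow : (3 : ℤ) ^ (m + 1) = 3 * 3 ^ m := by ring
    have hodd : (3 : ℤ) ^ m % 2 = 1 := by
      exact Int.odd_iff.1 (Odd.pow (by decide))
    -- the balanced ternary digit of `t` at `3 ^ m` decides how the two gates are oriented
    rcases lt_or_ge (2 * t) (-(3 ^ m)) with h1 | h1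
    · have hF' := ih (t + 3 ^ m) (by
        rw [← abs_two, ← abs_mul, abs_lt] at ht ⊢; constructor <;> omega)
      refine (((hF'.unitary_mul flip').gate 1 () m).gate flip () m).of_eq fun x => ?_
      simp only [encGate_Z_eq_quat, flip, flip', ← Matrix.mul_assoc, quat_mul,
        OneMemClass.coe_one, Matrix.mul_one]
      congr 2
      · simp only [star_zero, star_one, zero_mul, mul_zero, one_mul, sub_zero,
          zero_sub, add_zero, mul_neg, neg_mul, neg_neg, star_neg, star_mul', ec]
        rw [← Complex.exp_add, ← Complex.exp_add]
        congr 1; push_cast; ring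
      · simp
    · rcases le_or_gt (2 * t) (3 ^ m) with h2 | h2
      · have hF' := ih t (by
          rw [← abs_two, ← abs_mul, abs_lt] at ht ⊢; constructor <;> omega)
        refine (((hF'.unitary_mul flip').gate flip () m).gate 1 () m).of_eq fun x => ?_
        simp only [encGate_Z_eq_quat, flip, flip', ← Matrix.mul_assoc, quat_mul,
          OneMemClass.coe_one, Matrix.one_mul]
        congr 2
        · simp only [star_zero, star_one, zero_mul, mul_zero, one_mul, sub_zero,
            zero_sub, add_zero, mul_neg, neg_mul, neg_neg, star_neg, ec]
          rw [← Complex.exp_add, ← Complex.exp_add]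
          congr 1; push_cast; ring
        · simp
      · have hF' := ih (t - 3 ^ m) (by
          rw [← abs_two, ← abs_mul, abs_lt] at ht ⊢; constructor <;> omega)
        refine ((hF'.gate 1 () m).gate 1 () m).of_eq fun x => ?_
        simp only [encGate_Z_eq_quat, ← Matrix.mul_assoc, quat_mul,
          OneMemClass.coe_one, Matrix.one_mul]
        congr 2
        · simp only [star_zero, zero_mul, mul_zero, sub_zero, add_zero]
          rw [← Complex.exp_add, ← Complex.exp_add]
          congr 1; push_cast; ring
        · simp

lemma length_blockList (N m : ℕ) : (blockList N m).length = N + 2 * m := by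
  induction m with
  | zero => simp [blockList]
  | succ m ih => simp [blockList, ih]; ring

lemma sum_blockList (N m : ℕ) : ((blockList N m).map (3 ^ ·)).sum + 1 = N + 3 ^ m := by
  induction m with
  | zero => simp [blockList]
  | succ m ih => simp only [blockList, List.map_cons, List.sum_cons, pow_succ]; omega

lemma mem_blockList {N m : ℕ} (hm : 1 ≤ m) (i : ℕ) : i ∈ blockList N m ↔ i < m := by
  induction m, hm using Nat.le_induction with
  | base => simp [blockList, List.mem_replicate]
  | succ m _ ih => simp only [blockList, List.mem_cons, ih]; omega

/-- A trainable gate is approximated by the gates of a block: an integer multiple of `2` is split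
off from the frequency, and the rest has modulus at most `1`. The difference `D` of two elements of
`SU(2)` is a quaternion, so `Dᴴ * D` is a scalar matrix. -/
theorem exists_gate_approx (P : Pauli) {A α : ℝ} (hα : |α| ≤ A) {n m : ℕ} (hn : 3 ≤ n)
    (he : Even n) (hm : A + 2 ≤ 3 ^ m) :
    ∃ F : ℝ → Matrix (Fin 2) (Fin 2) ℂ,
      Realizable (fun _ : Unit => P.gen) (blockList (4 * n) m) F ∧
      ∀ x ∈ Set.Icc (0 : ℝ) 1, ∃ r : ℝ, 0 ≤ r ∧ r ≤ 12 * (1 / 2) ^ n ∧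
        (F x - encGate P.gen α x)ᴴ * (F x - encGate P.gen α x) = (r : ℂ) • 1 := by
  obtain ⟨B, hB⟩ := exists_gen_eq_conj P
  set t : ℤ := round (α / 2) with ht
  set b : ℝ := α / 2 - t with hbd
  have hb : |b| ≤ 1 / 2 := abs_sub_round (α / 2)
  have ht' : 2 * |t| < 3 ^ m := by
    have h1 : |(t : ℝ)| ≤ |α| / 2 + 1 / 2 := by
      have : (t : ℝ) = α / 2 - b := by rw [hbd]; ring
      rw [this]
      refine (abs_sub _ _).trans ?_
      rw [abs_div, abs_two]
      linarith
    have h2 : 2 * |(t : ℝ)| < 3 ^ m := by linarith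
    exact_mod_cast h2
  obtain ⟨a, c, hF, happ⟩ := exists_approx_fraction hb hn he
  have hBs : star (B : Matrix (Fin 2) (Fin 2) ℂ) * B = 1 := mem_unitaryGroup_iff'.1 B.2
  have hBs' : (B : Matrix (Fin 2) (Fin 2) ℂ) * star (B : Matrix (Fin 2) (Fin 2) ℂ) = 1 :=
    mem_unitaryGroup_iff.1 B.2
  have hR := Realizable.of_conj (G' := fun _ : Unit => P.gen) (fun _ => ⟨(), star B, by
    simp only [hB, Unitary.coe_star, star_star, Matrix.mul_assoc, hBs, Matrix.mul_one]
    simp only [← Matrix.mul_assoc, hBs, Matrix.one_mul]⟩) (realizable_integer (4 * n) m hF t ht')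
  refine ⟨_, (hR.mul_unitary (star B)).unitary_mul B, fun x hx =>
    ⟨‖a x - Complex.exp (Complex.I * b * x)‖ ^ 2 + ‖c x‖ ^ 2, by positivity, happ x hx, ?_⟩⟩
  · have hE : encGate P.gen α x = (B : Matrix (Fin 2) (Fin 2) ℂ)
        * (quat (Complex.exp (Complex.I * t * x)) 0 * quat (Complex.exp (Complex.I * b * x)) 0
          * star (B : Matrix (Fin 2) (Fin 2) ℂ)) := by
      rw [hB, encGate_conj, encGate_Z_eq_quat, quat_mul, Matrix.mul_assoc]
      congr 3
      · simp only [star_zero, zero_mul, sub_zero]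
        rw [← Complex.exp_add, hbd]; congr 1; push_cast; ring
      · simp
    have hq : (quat (Complex.exp (Complex.I * t * x)) 0)ᴴ
        * quat (Complex.exp (Complex.I * t * x)) 0 = 1 := by
      rw [quat_conjTranspose_mul_self, show Complex.I * (t : ℂ) * (x : ℂ)
        = Complex.I * ((t * x : ℝ) : ℂ) by push_cast; ring, norm_exp_I_mul]
      simp
    have hD := quat_conjTranspose_mul_self (a x - Complex.exp (Complex.I * b * x)) (c x - 0)
    rw [← quat_sub] at hD
    rw [hE, Unitary.coe_star, ← Matrix.mul_sub, ← Matrix.sub_mul, ← Matrix.mul_sub]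
    simp only [conjTranspose_mul, star_eq_conjTranspose, conjTranspose_conjTranspose,
      Matrix.mul_assoc] at hBs hBs' hq hD ⊢
    rw [← Matrix.mul_assoc _ (B : Matrix (Fin 2) (Fin 2) ℂ), hBs, Matrix.one_mul,
      ← Matrix.mul_assoc _ (quat (Complex.exp (Complex.I * t * x)) 0), hq, Matrix.one_mul,
      ← Matrix.mul_assoc _ (quat (a x) (c x) - _), hD, sub_zero]
    simp [hBs']

/-! ### Complete circuits -/

lemma encGate_gen_mem_unitaryGroup (P : Pauli) (c x : ℝ) :
    encGate P.gen c x ∈ unitaryGroup (Fin 2) ℂ := by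
  obtain ⟨B, hB⟩ := exists_gen_eq_conj P
  have h : ‖Complex.exp (Complex.I * c * x / 2)‖ ^ 2 + ‖(0 : ℂ)‖ ^ 2 = 1 := by
    rw [show Complex.I * (c : ℂ) * x / 2 = Complex.I * ((c * x / 2 : ℝ) : ℂ) by push_cast; ring,
      norm_exp_I_mul]
    simp
  rw [hB, encGate_conj, encGate_Z_eq_quat]
  exact mul_mem (mul_mem B.2 (quat_mem_unitaryGroup h)) (star B).2

lemma encGate_onQubit_mem_unitaryGroup {q : ℕ} (l : Fin q) (P : Pauli) (c x : ℝ) :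
    encGate (onQubit l P.gen) c x ∈ unitaryGroup (Basis q) ℂ := by
  rw [encGate_onQubit]
  exact (onQubitUnitary l ⟨_, encGate_gen_mem_unitaryGroup P c x⟩).2

lemma Realizable.mem_unitaryGroup {q : ℕ} {P : Pauli} {l : List ℕ}
    {F : ℝ → Matrix (Basis q) (Basis q) ℂ}
    (h : Realizable (fun j : Fin q => TernaryVQC.onQubit j P.gen) l F) (x : ℝ) :
    F x ∈ unitaryGroup (Basis q) ℂ := by
  induction h with
  | const W => exact W.2
  | gate W g e _ ih => exact mul_mem (mul_mem W.2 (encGate_onQubit_mem_unitaryGroup _ _ _ _)) ih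

lemma circuit_mem_unitaryGroup {q L : ℕ} (P : Pauli) (loc : Fin L → Fin q) (c : Fin L → ℝ)
    (W : Fin (L + 1) → unitaryGroup (Basis q) ℂ) (x : ℝ) :
    circuit P loc c W x ∈ unitaryGroup (Basis q) ℂ := by
  unfold circuit
  induction L with
  | zero => exact (W 0).2
  | succ L ih =>
    exact mul_mem (mul_mem (W _).2 (encGate_onQubit_mem_unitaryGroup _ _ _ _)) (ih _ _ _)

lemma frobNorm_eq_of_scalar {D : Matrix (Fin 2) (Fin 2) ℂ} {r : ℝ} (h : Dᴴ * D = (r : ℂ) • 1) :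
    frobNorm D = Real.sqrt (2 * r) := by
  rw [frobNorm, h]
  congr 1
  simp [trace_smul]
  ring

section norm

open scoped Matrix.Norms.L2Operator

lemma norm_le_one_of_mem_unitaryGroup {q : ℕ} {U : Matrix (Basis q) (Basis q) ℂ}
    (hU : U ∈ unitaryGroup (Basis q) ℂ) : ‖U‖ ≤ 1 :=
  (CStarRing.norm_of_mem_unitary hU).le

lemma norm_onQubit_le {q : ℕ} (l : Fin q) {D : Matrix (Fin 2) (Fin 2) ℂ} {r δ : ℝ} (hr : 0 ≤ r)
    (hδ : 0 ≤ δ) (hrδ : r ≤ δ ^ 2) (h : Dᴴ * D = (r : ℂ) • 1) : ‖onQubit l D‖ ≤ δ := by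
  have h1 : (onQubit l D)ᴴ * onQubit l D = (r : ℂ) • 1 := by
    rw [← onQubit_conjTranspose, ← onQubit_mul, h, onQubit_smul, onQubit_one]
  have h2 := l2_opNorm_conjTranspose_mul_self (onQubit l D)
  rw [h1, norm_smul, Complex.norm_real, Real.norm_eq_abs, abs_of_nonneg hr, CStarRing.norm_one]
    at h2
  nlinarith [norm_nonneg (onQubit l D)]

lemma norm_apply_le {ι : Type} [Fintype ι] [DecidableEq ι] (A : Matrix ι ι ℂ) (i j : ι) :
    ‖A i j‖ ≤ ‖A‖ := by
  have h := l2_opNorm_mulVec A (EuclideanSpace.single j 1)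
  have h' := PiLp.norm_apply_le (WithLp.toLp 2 (A *ᵥ (EuclideanSpace.single j (1 : ℂ)).ofLp)) i
  simp at h h'
  exact h'.trans h

lemma norm_output_sub_le {q : ℕ} {U V : Matrix (Basis q) (Basis q) ℂ}
    (hU : U ∈ unitaryGroup (Basis q) ℂ) (hV : V ∈ unitaryGroup (Basis q) ℂ)
    (M : Matrix (Basis q) (Basis q) ℂ) :
    ‖output M U - output M V‖ ≤ 2 * ‖U - V‖ * ‖M‖ := by
  have e : output M U - output M V
      = ((U - V)ᴴ * M * U + Vᴴ * M * (U - V)) (fun _ => 0) (fun _ => 0) := by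
    rw [output, output, ← Matrix.sub_apply]
    have : Uᴴ * M * U - Vᴴ * M * V = (U - V)ᴴ * M * U + Vᴴ * M * (U - V) := by
      rw [conjTranspose_sub]
      simp only [Matrix.sub_mul, Matrix.mul_sub]
      abel
    rw [this]
  rw [e]
  refine (norm_apply_le _ _ _).trans ((norm_add_le _ _).trans ?_)
  have hU1 := norm_le_one_of_mem_unitaryGroup hU
  have hV1 := norm_le_one_of_mem_unitaryGroup hV
  have hd := norm_nonneg (U - V)
  have hM := norm_nonneg M
  have h1 : ‖(U - V)ᴴ * M * U‖ ≤ ‖U - V‖ * ‖M‖ * 1 := by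
    refine (norm_mul_le _ _).trans (mul_le_mul ?_ hU1 (norm_nonneg _) (by positivity))
    exact (norm_mul_le _ _).trans_eq (by rw [l2_opNorm_conjTranspose])
  have h2 : ‖Vᴴ * M * (U - V)‖ ≤ 1 * ‖M‖ * ‖U - V‖ := by
    refine (norm_mul_le _ _).trans (mul_le_mul_of_nonneg_right ?_ hd)
    refine (norm_mul_le _ _).trans (mul_le_mul_of_nonneg_right ?_ hM)
    rwa [l2_opNorm_conjTranspose]
  linarith

/-- The errors of the single gates add up. -/
lemma exists_circuit_approx {P : Pauli} {A δ : ℝ} {l : List ℕ} (hδ : 0 ≤ δ)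
    (hone : ∀ α : ℝ, |α| ≤ A → ∃ F : ℝ → Matrix (Fin 2) (Fin 2) ℂ,
      Realizable (fun _ : Unit => P.gen) l F ∧
      ∀ x ∈ Set.Icc (0 : ℝ) 1, ∃ r : ℝ, 0 ≤ r ∧ r ≤ δ ^ 2 ∧
        (F x - encGate P.gen α x)ᴴ * (F x - encGate P.gen α x) = (r : ℂ) • 1)
    {q L : ℕ} (loc : Fin L → Fin q) (α : Fin L → ℝ) (W : Fin (L + 1) → unitaryGroup (Basis q) ℂ)
    (hα : ∀ i, |α i| ≤ A) :
    ∃ F : ℝ → Matrix (Basis q) (Basis q) ℂ,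
      Realizable (fun j : Fin q => onQubit j P.gen) (List.replicate L l).flatten F ∧
      ∀ x ∈ Set.Icc (0 : ℝ) 1, ‖F x - circuit P loc α W x‖ ≤ L * δ := by
  induction L with
  | zero => exact ⟨_, .const (W 0), fun x _ => by simp [circuit, interleave]⟩
  | succ L ih =>
    obtain ⟨F, hF, hF'⟩ := ih (fun i => loc i.castSucc) (fun i => α i.castSucc)
      (fun i => W i.castSucc) (fun i => hα _)
    obtain ⟨F₁, hF₁, hF₁'⟩ := hone (α (Fin.last L)) (hα _)
    refine ⟨_, ((hF₁.onQubit (loc (Fin.last L))).mul hF).unitary_mul (W (Fin.last _)),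
      fun x hx => ?_⟩
    obtain ⟨r, hr, hrδ, hD⟩ := hF₁' x hx
    have h1 := norm_onQubit_le (loc (Fin.last L)) hr hδ hrδ hD
    have h2 := hF' x hx
    rw [onQubit_sub, ← encGate_onQubit] at h1
    set V := circuit P (fun i => loc i.castSucc) (fun i => α i.castSucc)
      (fun i => W i.castSucc) x with hV
    have hc : circuit P loc α W x = (W (Fin.last _) : Matrix (Basis q) (Basis q) ℂ)
        * encGate (onQubit (loc (Fin.last L)) P.gen) (α (Fin.last L)) x * V := rfl
    set S := encGate (onQubit (loc (Fin.last L)) P.gen) (α (Fin.last L)) x with hS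
    set G := onQubit (loc (Fin.last L)) (F₁ x)
    have e : (W (Fin.last _) : Matrix (Basis q) (Basis q) ℂ) * (G * F x) - circuit P loc α W x
        = (W (Fin.last _) : Matrix (Basis q) (Basis q) ℂ) * ((G - S) * F x + S * (F x - V)) := by
      rw [hc]; noncomm_ring
    have n1 : ‖(G - S) * F x‖ ≤ δ * 1 := (norm_mul_le _ _).trans
      (mul_le_mul h1 (norm_le_one_of_mem_unitaryGroup (hF.mem_unitaryGroup x)) (norm_nonneg _) hδ)
    have n2 : ‖S * (F x - V)‖ ≤ 1 * (L * δ) := (norm_mul_le _ _).trans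
      (mul_le_mul (norm_le_one_of_mem_unitaryGroup (encGate_onQubit_mem_unitaryGroup _ _ _ _)) h2
        (norm_nonneg _) zero_le_one)
    rw [e]
    refine (norm_mul_le _ _).trans ((mul_le_of_le_one_left (norm_nonneg _)
      (norm_le_one_of_mem_unitaryGroup (W (Fin.last _)).2)).trans ((norm_add_le _ _).trans ?_))
    push_cast
    linarith

lemma approxBy_of_realizable {ε : ℝ} {P : Pauli} {l : List ℕ} {q : ℕ}
    {F V : ℝ → Matrix (Basis q) (Basis q) ℂ}
    (hF : Realizable (fun j : Fin q => onQubit j P.gen) l F)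
    (hV : ∀ x, V x ∈ unitaryGroup (Basis q) ℂ)
    (h : ∀ x ∈ Set.Icc (0 : ℝ) 1, ‖F x - V x‖ ≤ ε / 2) :
    ApproxBy ε P (ternary fun i : Fin l.length => l.get i.rev) V := by
  obtain ⟨loc, W, hW⟩ := hF.exists_interleave
  refine ⟨loc, W, fun x hx => ?_⟩
  have hx' := h x hx
  rw [show circuit P loc (ternary fun i : Fin l.length => l.get i.rev) W x = F x from hW x]
  have h0 := norm_nonneg (F x - V x)
  refine ⟨?_, fun M _ => (norm_output_sub_le (hF.mem_unitaryGroup x) (hV x) M).trans ?_⟩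
  · change ‖F x - V x‖ ≤ ε
    linarith
  · change _ ≤ ε * ‖M‖
    exact mul_le_mul_of_nonneg_right (by linarith) (norm_nonneg M)

end norm

lemma ternary_get_eq_unary {l : List ℕ} (hl : ∀ e ∈ l, e = 0) :
    (ternary fun i : Fin l.length => l.get i.rev) = unary l.length := by
  funext i
  simp [ternary, unary, hl _ (List.getElem_mem _)]

lemma approxBy_unary {ε : ℝ} {P : Pauli} {n q : ℕ} {V : ℝ → Matrix (Basis q) (Basis q) ℂ}
    (h : ApproxBy ε P (ternary fun i : Fin (List.replicate n 0).length =>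
      (List.replicate n 0).get i.rev) V) : ApproxBy ε P (unary n) V := by
  rw [ternary_get_eq_unary fun e he => List.eq_of_mem_replicate he] at h
  rwa [List.length_replicate] at h

/-! ### The frequency spectrum -/

lemma mem_spectrum_gen (P : Pauli) (a : ℝ) : a ∈ spectrum ℝ P.gen ↔ a = 1 / 2 ∨ a = -(1 / 2) := by
  have hI := Complex.I_mul_I
  have hdet : (algebraMap ℝ (Matrix (Fin 2) (Fin 2) ℂ) a - P.gen).det
      = (((a - 1 / 2) * (a + 1 / 2) : ℝ) : ℂ) := by
    cases P <;> simp [det_fin_two, Pauli.gen, Pauli.mat, Matrix.algebraMap_matrix_apply] <;> grind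
  rw [spectrum.mem_iff, isUnit_iff_isUnit_det, hdet, isUnit_iff_ne_zero, not_not,
    Complex.ofReal_eq_zero, mul_eq_zero, sub_eq_zero, add_eq_zero_iff_eq_neg]

/-- If the subset sums of the prefactors `3 ^ e_j` are all the integers up to their total `K`, then
the spectrum consists of all the integers from `-K` to `K`. -/
lemma freqSpectrum_ternary (P : Pauli) {k K : ℕ} {e : Fin k → ℕ} (hK : ∑ j, 3 ^ e j = K)
    (hsub : ∀ n ≤ K, ∃ s : Fin k → Fin 2, ∑ j, (s j : ℕ) * 3 ^ e j = n) :
    freqSpectrum P (ternary e) = {ω : ℝ | ∃ n : ℤ, |n| ≤ (K : ℤ) ∧ ω = n} := by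
  have half (s : Fin 2) : (if s = 1 then 1 / 2 else -(1 / 2) : ℝ) - -(1 / 2) = ((s : ℕ) : ℝ) := by
    fin_cases s <;> norm_num
  have hup (s : Fin 2) : (if s = 1 then 1 / 2 else -(1 / 2) : ℝ) ∈ spectrum ℝ P.gen := by
    rw [mem_spectrum_gen]; split <;> simp
  have hdown : (-(1 / 2) : ℝ) ∈ spectrum ℝ P.gen := by rw [mem_spectrum_gen]; simp
  have hsum (s : Fin k → Fin 2) {n : ℕ} (hs : ∑ j, (s j : ℕ) * 3 ^ e j = n) :
      ∑ j, ternary e j * (if s j = 1 then 1 / 2 else -(1 / 2)) - ∑ j, ternary e j * -(1 / 2)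
        = (n : ℝ) := by
    rw [← Finset.sum_sub_distrib, ← hs, Nat.cast_sum]
    refine Finset.sum_congr rfl fun j _ => ?_
    rw [← mul_sub, half, ternary]
    push_cast; ring
  ext ω
  constructor
  · rintro ⟨a, b, ha, hb, rfl⟩
    have hd (j : Fin k) : ∃ d : ℤ, |d| ≤ 1 ∧ a j - b j = d := by
      rcases (mem_spectrum_gen P _).1 (ha j) with h | h <;>
        rcases (mem_spectrum_gen P _).1 (hb j) with h' | h' <;> rw [h, h']
      · exact ⟨0, by simp, by simp⟩
      · exact ⟨1, by simp, by norm_num⟩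
      · exact ⟨-1, by simp, by norm_num⟩
      · exact ⟨0, by simp, by simp⟩
    choose d hd1 hd2 using hd
    refine ⟨∑ j, 3 ^ e j * d j, ?_, ?_⟩
    · refine (Finset.abs_sum_le_sum_abs _ _).trans ?_
      rw [← hK]
      push_cast
      refine Finset.sum_le_sum fun j _ => ?_
      rw [abs_mul, abs_of_pos (by positivity : (0 : ℤ) < 3 ^ e j)]
      exact mul_le_of_le_one_right (by positivity) (hd1 j)
    · rw [← Finset.sum_sub_distrib]
      push_cast
      refine Finset.sum_congr rfl fun j _ => ?_
      rw [← mul_sub, hd2, ternary]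
  · rintro ⟨n, hn, rfl⟩
    obtain ⟨s, hs⟩ := hsub n.natAbs (by rw [Int.abs_eq_natAbs] at hn; omega)
    rcases le_total 0 n with h | h
    · refine ⟨_, _, fun j => hup (s j), fun _ => hdown, ?_⟩
      rw [hsum s hs]
      have : ((n.natAbs : ℤ) : ℝ) = n := by congr 1; omega
      rw [← this, Int.cast_natCast]
    · refine ⟨_, _, fun _ => hdown, fun j => hup (s j), ?_⟩
      rw [← neg_sub, hsum s hs]
      have : ((-(n.natAbs : ℤ) : ℤ) : ℝ) = n := by congr 1; omega
      rw [← this, Int.cast_neg, Int.cast_natCast]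

lemma ncard_integers (K : ℕ) :
    {ω : ℝ | ∃ n : ℤ, |n| ≤ (K : ℤ) ∧ ω = n}.ncard = 2 * K + 1 := by
  have h : {ω : ℝ | ∃ n : ℤ, |n| ≤ (K : ℤ) ∧ ω = n}
      = (Int.cast : ℤ → ℝ) '' (Finset.Icc (-(K : ℤ)) K : Finset ℤ) := by
    ext ω
    simp only [Set.mem_ofPred_eq, Set.mem_image, Finset.coe_Icc, Set.mem_Icc, ← abs_le, eq_comm]
  rw [h, Set.ncard_image_of_injective _ Int.cast_injective, Set.ncard_coe_finset, Int.card_Icc]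
  omega

/-- The subset sums of the powers `3 ^ e`, for `e` in the list `l`, fill an interval. -/
def FillsInterval (l : List ℕ) : Prop :=
  ∀ n ≤ (l.map (3 ^ ·)).sum, ∃ l' : List ℕ, l'.Sublist l ∧ (l'.map (3 ^ ·)).sum = n

lemma fillsInterval_replicate (N : ℕ) : FillsInterval (List.replicate N 0) := by
  intro n hn
  exact ⟨List.replicate n 0, List.replicate_sublist_replicate 0 |>.2 (by simpa using hn), by simp⟩

lemma FillsInterval.append {l l' : List ℕ} (h : FillsInterval l) (h' : FillsInterval l') :
    FillsInterval (l ++ l') := by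
  intro n hn
  rw [List.map_append, List.sum_append] at hn
  obtain ⟨a, ha, ha'⟩ := h (min n (l.map (3 ^ ·)).sum) (min_le_right _ _)
  obtain ⟨b, hb, hb'⟩ := h' (n - min n (l.map (3 ^ ·)).sum) (by omega)
  exact ⟨a ++ b, ha.append hb, by rw [List.map_append, List.sum_append, ha', hb']; omega⟩

lemma fillsInterval_flatten (L : ℕ) {l : List ℕ} (h : FillsInterval l) :
    FillsInterval (List.replicate L l).flatten := by
  induction L with
  | zero => simpa using fillsInterval_replicate 0
  | succ L ih => rw [List.replicate_succ, List.flatten_cons]; exact h.append ih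

lemma fillsInterval_blockList (N m : ℕ) (hN : 1 ≤ N) : FillsInterval (blockList N m) := by
  induction m with
  | zero => exact fillsInterval_replicate N
  | succ m ih =>
    intro n hn
    have hS := sum_blockList N m
    simp only [blockList, List.map_cons, List.sum_cons] at hn
    set S := ((blockList N m).map (3 ^ ·)).sum
    rcases le_or_gt n S with h1 | h1
    · obtain ⟨l', hl, hl'⟩ := ih n h1
      exact ⟨l', (hl.cons m).cons m, hl'⟩
    rcases le_or_gt n (S + 3 ^ m) with h2 | h2
    · obtain ⟨l', hl, hl'⟩ := ih (n - 3 ^ m) (by omega)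
      refine ⟨m :: l', (hl.cons_cons m).cons m, ?_⟩
      rw [List.map_cons, List.sum_cons, hl']; omega
    · obtain ⟨l', hl, hl'⟩ := ih (n - 2 * 3 ^ m) (by omega)
      refine ⟨m :: m :: l', (hl.cons_cons m).cons_cons m, ?_⟩
      simp only [List.map_cons, List.sum_cons, hl']; omega

lemma FillsInterval.exists_sum {l : List ℕ} (h : FillsInterval l) {n : ℕ}
    (hn : n ≤ (l.map (3 ^ ·)).sum) :
    ∃ s : Fin l.length → Fin 2, ∑ j, (s j : ℕ) * 3 ^ l.get j.rev = n := by
  have key {l' l : List ℕ} (h : l'.Sublist l) :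
      ∃ s : Fin l.length → Fin 2, ∑ j, (s j : ℕ) * 3 ^ l.get j = (l'.map (3 ^ ·)).sum := by
    induction h with
    | slnil => exact ⟨Fin.elim0, by simp⟩
    | cons a _ ih =>
      obtain ⟨s, hs⟩ := ih
      refine ⟨Fin.cons 0 s, ?_⟩
      simp only [List.length_cons, Fin.sum_univ_succ, Fin.cons_zero, Fin.cons_succ, ← hs]
      simp
    | cons_cons a _ ih =>
      obtain ⟨s, hs⟩ := ih
      refine ⟨Fin.cons 1 s, ?_⟩
      simp only [List.length_cons, Fin.sum_univ_succ, Fin.cons_zero, Fin.cons_succ, List.map_cons,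
        List.sum_cons, ← hs]
      simp
  obtain ⟨l', hl, hl'⟩ := h n hn
  obtain ⟨s, hs⟩ := key hl
  refine ⟨fun j => s j.rev, ?_⟩
  rw [← hl', ← hs]
  exact Equiv.sum_comp Fin.revPerm (fun j => (s j : ℕ) * 3 ^ l.get j)

lemma sum_get_rev (l : List ℕ) : ∑ j : Fin l.length, 3 ^ l.get j.rev = (l.map (3 ^ ·)).sum := by
  rw [← Fin.sum_univ_fun_getElem]
  exact Equiv.sum_comp Fin.revPerm (fun j : Fin l.length => 3 ^ l.get j)

/-! ### Model outputs are trigonometric polynomials -/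

/-- The entries of `F` are, up to the common phase `exp (-i K x / 2)`, polynomials of degree `K` in
`exp (i x)`. -/
def IsTrigMatrix {ι : Type} (K : ℕ) (F : ℝ → Matrix ι ι ℂ) : Prop :=
  ∃ A : Matrix ι ι ℂ[X], (∀ i j, (A i j).natDegree ≤ K) ∧ ∀ x i j,
    F x i j = Complex.exp (-(Complex.I * K * x / 2)) * (A i j).eval (Complex.exp (Complex.I * x))

lemma isTrigMatrix_const {ι : Type} (W : Matrix ι ι ℂ) : IsTrigMatrix 0 (fun _ => W) :=
  ⟨fun i j => C (W i j), fun _ _ => by simp, fun x i j => by simp⟩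

lemma IsTrigMatrix.mul {ι : Type} [Fintype ι] {K L : ℕ} {F G : ℝ → Matrix ι ι ℂ}
    (hF : IsTrigMatrix K F) (hG : IsTrigMatrix L G) :
    IsTrigMatrix (K + L) (fun x => F x * G x) := by
  obtain ⟨A, hA, hA'⟩ := hF
  obtain ⟨B, hB, hB'⟩ := hG
  refine ⟨A * B, fun i j => ?_, fun x i j => ?_⟩
  · rw [Matrix.mul_apply]
    exact natDegree_sum_le_of_forall_le _ _ fun l _ =>
      natDegree_mul_le.trans (add_le_add (hA _ _) (hB _ _))
  · dsimp only
    rw [Matrix.mul_apply, Matrix.mul_apply, eval_finsetSum, Finset.mul_sum]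
    refine Finset.sum_congr rfl fun l _ => ?_
    have : Complex.exp (-(Complex.I * (K + L : ℕ) * x / 2))
        = Complex.exp (-(Complex.I * K * x / 2)) * Complex.exp (-(Complex.I * L * x / 2)) := by
      rw [← Complex.exp_add]; congr 1; push_cast; ring
    rw [hA', hB', this, eval_mul]
    ring

lemma isTrigMatrix_encGate_gen (P : Pauli) (n : ℕ) :
    IsTrigMatrix n (fun x => encGate P.gen n x) := by
  obtain ⟨B, hB⟩ := exists_gen_eq_conj P
  have hZ : IsTrigMatrix n (fun x => encGate Pauli.Z.gen n x) := by
    refine ⟨diagonal fun i => if i = 0 then X ^ n else 1, fun i j => ?_, fun x i j => ?_⟩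
    · fin_cases i <;> fin_cases j <;> simp
    · dsimp only
      rw [encGate_Z]
      have : Complex.exp (Complex.I * n * x / 2)
          = Complex.exp (-(Complex.I * n * x / 2)) * Complex.exp (Complex.I * x) ^ n := by
        rw [← Complex.exp_nat_mul, ← Complex.exp_add]; congr 1; ring
      fin_cases i <;> fin_cases j <;> simp [← this] <;> ring_nf
  have h := ((isTrigMatrix_const (B : Matrix (Fin 2) (Fin 2) ℂ)).mul hZ).mul
    (isTrigMatrix_const (star (B : Matrix (Fin 2) (Fin 2) ℂ)))
  simpa only [hB, encGate_conj, zero_add, add_zero] using h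

lemma IsTrigMatrix.onQubit {q K : ℕ} {F : ℝ → Matrix (Fin 2) (Fin 2) ℂ} (hF : IsTrigMatrix K F)
    (l : Fin q) : IsTrigMatrix K (fun x => onQubit l (F x)) := by
  obtain ⟨A, hA, hA'⟩ := hF
  refine ⟨fun a b => if ∀ j, j ≠ l → a j = b j then A (a l) (b l) else 0, fun a b => ?_,
    fun x a b => ?_⟩
  · dsimp only
    split
    · exact hA _ _
    · simp
  · simp only [TernaryVQC.onQubit, of_apply, hA']
    split <;> simp

lemma isTrigMatrix_circuit {q k : ℕ} (P : Pauli) (loc : Fin k → Fin q) (e : Fin k → ℕ)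
    (W : Fin (k + 1) → unitaryGroup (Basis q) ℂ) :
    IsTrigMatrix (∑ j, 3 ^ e j) (circuit P loc (ternary e) W) := by
  induction k with
  | zero => exact isTrigMatrix_const (W 0 : Matrix (Basis q) (Basis q) ℂ)
  | succ k ih =>
    have h1 := ((isTrigMatrix_encGate_gen P (3 ^ e (Fin.last k))).onQubit (loc (Fin.last k)))
    have h2 := ((isTrigMatrix_const (W (Fin.last (k + 1)) : Matrix (Basis q) (Basis q) ℂ)).mul
      h1).mul (ih (fun i => loc i.castSucc) (fun i => e i.castSucc) (fun i => W i.castSucc))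
    rw [Fin.sum_univ_castSucc, add_comm]
    simp only [← encGate_onQubit] at h2
    rw [zero_add] at h2
    simp only [Nat.cast_pow, Nat.cast_ofNat] at h2
    exact h2

lemma output_eq_sum {q : ℕ} (M U : Matrix (Basis q) (Basis q) ℂ) :
    output M U = ∑ a, ∑ b, star (U a 0) * M a b * U b 0 := by
  rw [output, Matrix.mul_apply, Finset.sum_comm]
  refine Finset.sum_congr rfl fun a _ => ?_
  rw [Matrix.mul_apply, Finset.sum_mul]
  rfl

lemma exists_output_eq_trigPoly {q K : ℕ} {F : ℝ → Matrix (Basis q) (Basis q) ℂ}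
    (hF : IsTrigMatrix K F) (M : Matrix (Basis q) (Basis q) ℂ) :
    ∃ c : ℤ → ℂ, ∀ x : ℝ, output M (F x) = trigPoly K c x := by
  obtain ⟨A, hA, hA'⟩ := hF
  set R : ℂ[X] := ∑ a, ∑ b, C (M a b) * (reflect K ((A a 0).map (starRingEnd ℂ)) * A b 0) with hR
  have hRd : R.natDegree ≤ 2 * K := by
    refine natDegree_sum_le_of_forall_le _ _ fun a _ => natDegree_sum_le_of_forall_le _ _ fun b _ =>
      (natDegree_C_mul_le _ _).trans (natDegree_mul_le.trans ?_)
    have h := natDegree_reflect_le (N := K) (p := (A a 0).map (starRingEnd ℂ))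
    have h' : ((A a 0).map (starRingEnd ℂ)).natDegree ≤ K := natDegree_map_le.trans (hA a 0)
    have h1 := h.trans (max_le le_rfl h')
    have h2 := hA b 0
    omega
  refine ⟨fun n => R.coeff (n + K).toNat, fun x => ?_⟩
  set z := Complex.exp (Complex.I * x) with hz
  have hz0 : z ≠ 0 := Complex.exp_ne_zero _
  have hzn : ‖z‖ = 1 := norm_exp_I_mul x
  have h1 : z ^ K * output M (F x) = R.eval z := by
    rw [output_eq_sum, Finset.mul_sum, hR, eval_finsetSum]
    refine Finset.sum_congr rfl fun a _ => ?_
    rw [Finset.mul_sum, eval_finsetSum]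
    refine Finset.sum_congr rfl fun b _ => ?_
    rw [eval_mul, eval_mul, eval_C, eval_reflect_conj (hA a 0) hzn, hA', hA', star_mul']
    have : star (Complex.exp (-(Complex.I * K * x / 2))) * Complex.exp (-(Complex.I * K * x / 2))
        = 1 := by
      rw [Complex.star_def, ← Complex.exp_conj, ← Complex.exp_add, ← Complex.exp_zero]
      congr 1; simp [map_ofNat]; ring
    linear_combination (z ^ K * star ((A a 0).eval z) * M a b * (A b 0).eval z) * this
  have h2 : z ^ K * trigPoly K (fun n => R.coeff (n + K).toNat) x = R.eval z := by
    rw [eval_eq_sum_range' (Nat.lt_succ_of_le hRd), trigPoly, Finset.mul_sum]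
    refine Finset.sum_nbij' (fun n => (n + K).toNat) (fun j => (j : ℤ) - K) ?_ ?_ ?_ ?_ ?_
    · intro n hn
      simp only [Finset.mem_Icc, Finset.mem_range] at hn ⊢
      omega
    · intro j hj
      simp only [Finset.mem_Icc, Finset.mem_range] at hj ⊢
      omega
    · intro n hn
      simp only [Finset.mem_Icc] at hn ⊢
      omega
    · intro j _
      simp
    · intro n hn
      simp only [Finset.mem_Icc] at hn
      have e : ((n + K).toNat : ℂ) = (n : ℂ) + K := by
        have : (((n + K).toNat : ℤ) : ℂ) = ((n + K : ℤ) : ℂ) := by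
          rw [Int.toNat_of_nonneg (by omega)]
        push_cast at this
        exact this
      have : z ^ K * Complex.exp (Complex.I * n * x) = z ^ (n + K).toNat := by
        rw [hz, ← Complex.exp_nat_mul, ← Complex.exp_nat_mul, ← Complex.exp_add, e]
        congr 1; ring
      rw [← this]; ring
  exact mul_left_cancel₀ (pow_ne_zero K hz0) (h1.trans h2.symm)

/-! ### Parameter count: lower bound -/

/-- Fourier coefficients are recovered from the values at `2 K + 1` equidistant points. -/
lemma sum_trigPoly_mul_exp (K : ℕ) (c : ℤ → ℂ) {m : ℤ} (hm : m ∈ Finset.Icc (-(K : ℤ)) K) :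
    ∑ l ∈ Finset.range (2 * K + 1), trigPoly K c (2 * Real.pi * l / (2 * K + 1 : ℕ))
        * Complex.exp (-(Complex.I * m * (2 * Real.pi * l / (2 * K + 1 : ℕ) : ℝ)))
      = (2 * K + 1 : ℕ) * c m := by
  set N := 2 * K + 1 with hN
  have hN0 : N ≠ 0 := by omega
  have hNc : (N : ℂ) ≠ 0 := by exact_mod_cast hN0
  have hζ := Complex.isPrimitiveRoot_exp N hN0
  set ζ := Complex.exp (2 * Real.pi * Complex.I / N)
  have hexp (n : ℤ) (l : ℕ) : Complex.exp (Complex.I * n * (2 * Real.pi * l / N : ℝ))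
      * Complex.exp (-(Complex.I * m * (2 * Real.pi * l / N : ℝ))) = (ζ ^ (n - m)) ^ l := by
    rw [← Complex.exp_add, ← Complex.exp_int_mul, ← Complex.exp_nat_mul]
    congr 1; push_cast; field_simp; ring
  have hgeom (n : ℤ) (hn : n ∈ Finset.Icc (-(K : ℤ)) K) :
      ∑ l ∈ Finset.range N, (ζ ^ (n - m)) ^ l = if n = m then (N : ℂ) else 0 := by
    split_ifs with h
    · simp [h]
    · have h1 : ζ ^ (n - m) ≠ 1 := by
        rw [Ne, hζ.zpow_eq_one_iff_dvd]
        intro hd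
        rw [Finset.mem_Icc] at hn hm
        have := Int.eq_zero_of_abs_lt_dvd hd (by rw [abs_lt]; omega)
        omega
      have h2 : (ζ ^ (n - m)) ^ N = 1 := by
        rw [← zpow_natCast, ← _root_.zpow_mul, mul_comm, _root_.zpow_mul, zpow_natCast,
          hζ.pow_eq_one, _root_.one_zpow]
      rw [geom_sum_eq h1, h2, sub_self, zero_div]
  simp only [trigPoly, Finset.sum_mul]
  rw [Finset.sum_comm]
  have : ∀ n ∈ Finset.Icc (-(K : ℤ)) K, ∑ l ∈ Finset.range N,
      c n * Complex.exp (Complex.I * n * (2 * Real.pi * l / N : ℝ))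
        * Complex.exp (-(Complex.I * m * (2 * Real.pi * l / N : ℝ)))
      = if n = m then (N : ℂ) * c n else 0 := by
    intro n hn
    simp only [mul_assoc (c n), hexp]
    rw [← Finset.mul_sum, hgeom n hn]
    split_ifs <;> ring
  rw [Finset.sum_congr rfl this, Finset.sum_ite_eq', if_pos hm]

lemma contDiff_interleave {E : Type*} [NormedAddCommGroup E] [NormedSpace ℝ E] {ι : Type}
    [Fintype ι] [DecidableEq ι] {L : ℕ} (S : Fin L → Matrix ι ι ℂ)
    (W : Fin (L + 1) → E → unitaryGroup ι ℂ)
    (hW : ∀ j a b, ContDiff ℝ 1 fun θ => (W j θ : Matrix ι ι ℂ) a b) (a b : ι) :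
    ContDiff ℝ 1 fun θ => interleave L S (fun j => W j θ) a b := by
  induction L generalizing a b with
  | zero => exact hW 0 a b
  | succ L ih =>
    simp only [interleave, Matrix.mul_apply]
    refine ContDiff.sum fun i _ => ContDiff.mul (ContDiff.sum fun i' _ => ?_) ?_
    · exact (hW _ _ _).mul contDiff_const
    · exact ih _ _ (fun j => hW _) i b

/-- The sequence on `ℤ` with value `a` at `0` and `u n` at `n + 1`, extended by conjugation. -/
def hermitianExtend (a : ℝ) (u : ℕ → ℂ) : ℤ → ℂ
  | Int.ofNat 0 => a
  | Int.ofNat (n + 1) => u n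
  | Int.negSucc n => star (u n)

lemma hermitianExtend_neg (a : ℝ) (u : ℕ → ℂ) (n : ℤ) :
    hermitianExtend a u (-n) = star (hermitianExtend a u n) := by
  match n with
  | Int.ofNat 0 => exact (Complex.conj_ofReal a).symm
  | Int.ofNat (n + 1) => rfl
  | Int.negSucc n => exact (star_star (u n)).symm

/-- Independent control of `2 K + 1` real coefficients needs as many parameters: otherwise the
coefficients would be a smooth function of fewer variables, and the complement of its range would
be dense. -/
theorem le_of_controlsCoeffs {k K p : ℕ} {P : Pauli} {c : Fin k → ℝ}
    (h : ControlsCoeffs P c K p) : 2 * K + 1 ≤ p := by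
  obtain ⟨q, loc, d, W, M, hW, -, hd, c₀, δ, hc₀, hδ, hctrl⟩ := h
  by_contra! hp
  let coeff (m : ℤ) (θ : (j : Fin (k + 1)) → Fin (d j) → ℝ) : ℂ :=
    ((2 * K + 1 : ℕ) : ℂ)⁻¹ * ∑ l ∈ Finset.range (2 * K + 1),
      output M (circuit P loc c (fun j => W j (θ j)) (2 * Real.pi * l / (2 * K + 1 : ℕ)))
        * Complex.exp (-(Complex.I * m * (2 * Real.pi * l / (2 * K + 1 : ℕ) : ℝ)))
  have hcoeff (m : ℤ) : ContDiff ℝ 1 (coeff m) := by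
    refine contDiff_const.mul (ContDiff.sum fun l _ => ContDiff.mul ?_ contDiff_const)
    simp only [output_eq_sum]
    have hU (a b : Basis q) := contDiff_interleave
      (fun i => encGate (onQubit (loc i) P.gen) (c i) (2 * Real.pi * l / (2 * K + 1 : ℕ)))
      (fun j (θ : (j : Fin (k + 1)) → Fin (d j) → ℝ) => W j (θ j))
      (fun j a b => ((hW j a b).of_le (by exact_mod_cast le_top)).comp
        (ContinuousLinearMap.proj (R := ℝ) (φ := fun j => Fin (d j) → ℝ) j).contDiff) a b
    refine ContDiff.sum fun a _ => ContDiff.sum fun b _ => ContDiff.mul (ContDiff.mul ?_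
      contDiff_const) (hU b _)
    exact Complex.conjCLE.contDiff.comp (hU a _)
  let Φ (θ : (j : Fin (k + 1)) → Fin (d j) → ℝ) : ℝ × (Fin K → ℝ) × (Fin K → ℝ) :=
    ((coeff 0 θ).re, fun n => (coeff (n + 1) θ).re, fun n => (coeff (n + 1) θ).im)
  have hΦ : ContDiff ℝ 1 Φ := by
    refine ContDiff.prodMk ?_ (ContDiff.prodMk (contDiff_pi.2 fun n => ?_)
      (contDiff_pi.2 fun n => ?_))
    · exact Complex.reCLM.contDiff.comp (hcoeff 0)
    · exact Complex.reCLM.contDiff.comp (hcoeff _)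
    · exact Complex.imCLM.contDiff.comp (hcoeff _)
  have hdense := hΦ.dense_compl_range_of_finrank_lt_finrank (by
    rw [Module.finrank_pi_fintype]
    simp only [Module.finrank_prod, Module.finrank_pi, Fintype.card_fin, Module.finrank_self]
    omega)
  obtain ⟨v, hv, hvΦ⟩ := hdense.exists_mem_open
    (Metric.isOpen_ball (x := ((c₀ 0).re, (fun n : Fin K => (c₀ (n + 1)).re),
      (fun n : Fin K => (c₀ (n + 1)).im))) (ε := δ / 2)) ⟨_, Metric.mem_ball_self (half_pos hδ)⟩
  refine hv ?_
  obtain ⟨v₀, v₁, v₂⟩ := v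
  simp only [Metric.mem_ball, Prod.dist_eq, max_lt_iff, dist_pi_lt_iff (half_pos hδ)] at hvΦ
  obtain ⟨h0, h1, h2⟩ := hvΦ
  set u : ℕ → ℂ := fun n => if h : n < K then ⟨v₁ ⟨n, h⟩, v₂ ⟨n, h⟩⟩ else c₀ (n + 1) with hu
  have hun (n : ℕ) : ‖u n - c₀ (n + 1)‖ < δ := by
    by_cases h : n < K
    · have e1 := h1 ⟨n, h⟩
      have e2 := h2 ⟨n, h⟩
      simp only [hu, dif_pos h]
      refine (Complex.norm_le_abs_re_add_abs_im _).trans_lt ?_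
      rw [Real.dist_eq] at e1 e2
      simp only [Complex.sub_re, Complex.sub_im]
      linarith
    · simpa [hu, h] using hδ
  have hc00 : ((c₀ 0).re : ℂ) = c₀ 0 := by
    have := hc₀ 0
    rw [neg_zero] at this
    exact Complex.conj_eq_iff_re.1 this.symm
  obtain ⟨θ, hθ⟩ := hctrl (hermitianExtend v₀ u) (hermitianExtend_neg v₀ u) (fun n => by
    match n with
    | Int.ofNat 0 =>
      change ‖(v₀ : ℂ) - c₀ 0‖ < δ
      rw [← hc00, ← Complex.ofReal_sub, Complex.norm_real, Real.norm_eq_abs, ← Real.dist_eq]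
      linarith
    | Int.ofNat (n + 1) => exact hun n
    | Int.negSucc n =>
      have : c₀ (Int.negSucc n) = star (c₀ (n + 1)) := by rw [← hc₀]; rfl
      rw [this]
      change ‖star (u n) - _‖ < δ
      rw [← star_sub, norm_star]
      exact hun n)
  have hco (m : ℤ) (hm : m ∈ Finset.Icc (-(K : ℤ)) K) : coeff m θ = hermitianExtend v₀ u m := by
    have := sum_trigPoly_mul_exp K (hermitianExtend v₀ u) hm
    simp only [coeff, hθ]
    rw [this, inv_mul_cancel_left₀]
    exact_mod_cast (2 * K).succ_ne_zero
  have hcn (n : Fin K) : coeff (n + 1) θ = ⟨v₁ n, v₂ n⟩ := by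
    rw [hco _ (by rw [Finset.mem_Icc]; have := n.2; omega)]
    change u n = _
    simp [hu]
  refine ⟨θ, ?_⟩
  simp only [Φ, hcn]
  rw [hco 0 (by simp)]
  rfl

/-! ### Parameter count: a circuit with `2 K + 1` parameters -/

lemma exists_interleave_eq_mul {ι : Type} [Fintype ι] [DecidableEq ι] {L : ℕ}
    (V : unitaryGroup ι ℂ) (W : Fin (L + 1) → unitaryGroup ι ℂ) :
    ∃ W' : Fin (L + 1) → unitaryGroup ι ℂ, ∀ S, interleave L S W' = V * interleave L S W := by
  cases L with
  | zero => exact ⟨fun i => V * W i, fun S => rfl⟩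
  | succ L =>
    refine ⟨Function.update W (Fin.last _) (V * W (Fin.last _)), fun S => ?_⟩
    have (i : Fin (L + 1)) : Function.update W (Fin.last _) (V * W (Fin.last _)) i.castSucc
        = W i.castSucc := Function.update_of_ne (Fin.castSucc_lt_last i).ne _ _
    simp only [interleave, this, Function.update_self, Submonoid.coe_mul, Matrix.mul_assoc]

lemma interleave_update_zero {ι : Type} [Fintype ι] [DecidableEq ι] {L : ℕ}
    (S : Fin L → Matrix ι ι ℂ) (V : unitaryGroup ι ℂ) (W : Fin (L + 1) → unitaryGroup ι ℂ) :
    interleave L S (Function.update W 0 (W 0 * V)) = interleave L S W * V := by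
  induction L with
  | zero => simp [interleave]
  | succ L ih =>
    have h1 : Function.update W 0 (W 0 * V) (Fin.last (L + 1)) = W (Fin.last (L + 1)) :=
      Function.update_of_ne (Fin.last_pos).ne' _ _
    have h2 : (fun i : Fin (L + 1) => Function.update W 0 (W 0 * V) i.castSucc)
        = Function.update (fun i : Fin (L + 1) => W i.castSucc) 0 (W (Fin.castSucc 0) * V) := by
      funext i
      rcases eq_or_ne i 0 with rfl | hi
      · simp
      · rw [Function.update_of_ne hi, Function.update_of_ne (by simpa using hi)]
    simp only [interleave, h1, h2, ih _ (fun i => W i.castSucc), Matrix.mul_assoc]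

lemma encGate_onQubit_Z {q : ℕ} (l : Fin q) (c x : ℝ) :
    encGate (onQubit l Pauli.Z.gen) c x = diagonal (fun a : Basis q =>
      Complex.exp (Complex.I * c * x * (if a l = 0 then 1 / 2 else -(1 / 2)))) := by
  rw [encGate_onQubit, encGate_Z]
  ext a b
  simp only [onQubit, of_apply, diagonal_apply]
  by_cases hab : a = b
  · subst hab; simp
  · rw [if_neg hab]
    by_cases h : ∀ j, j ≠ l → a j = b j
    · rw [if_pos h, if_neg]
      intro hl
      exact hab (funext fun j => if hj : j = l then hj ▸ hl else h j hj)
    · rw [if_neg h]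

/-- For ansatz layers that diagonalize the gates the circuit is diagonal. -/
lemma exists_circuit_eq_diagonal {q k : ℕ} (P : Pauli) (loc : Fin k → Fin q) (c : Fin k → ℝ) :
    ∃ W : Fin (k + 1) → unitaryGroup (Basis q) ℂ, ∀ x : ℝ,
      circuit P loc c W x = diagonal (fun a : Basis q =>
        Complex.exp (Complex.I * x
          * ∑ j, (c j : ℂ) * (if a (loc j) = 0 then 1 / 2 else -(1 / 2)))) := by
  induction k with
  | zero => exact ⟨fun _ => 1, fun x => by simp [circuit, interleave]⟩
  | succ k ih =>
    obtain ⟨W, hW⟩ := ih (fun i => loc i.castSucc) (fun i => c i.castSucc)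
    obtain ⟨B, hB⟩ := exists_gen_eq_conj P
    set V := onQubitUnitary (loc (Fin.last k)) B
    have hV : ((star V : unitaryGroup (Basis q) ℂ) : Matrix (Basis q) (Basis q) ℂ) * V = 1 :=
      mem_unitaryGroup_iff'.1 V.2
    obtain ⟨W', hW'⟩ := exists_interleave_eq_mul V W
    refine ⟨Fin.snoc (α := fun _ => unitaryGroup (Basis q) ℂ) W' (star V), fun x => ?_⟩
    have hP : onQubit (loc (Fin.last k)) P.gen
        = V * onQubit (loc (Fin.last k)) Pauli.Z.gen * star (V : Matrix (Basis q) (Basis q) ℂ) := by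
      rw [hB, onQubit_mul, onQubit_mul]
      congr 1
      rw [star_eq_conjTranspose, onQubit_conjTranspose]
      rfl
    have hx := hW x
    simp only [circuit] at hx
    simp only [circuit, interleave, Fin.snoc_last, Fin.snoc_castSucc, hW', hx, hP, encGate_conj]
    rw [Unitary.coe_star] at hV ⊢
    simp only [← Matrix.mul_assoc, hV, Matrix.one_mul]
    rw [Matrix.mul_assoc (encGate _ _ _), hV, Matrix.mul_one, encGate_onQubit_Z,
      diagonal_mul_diagonal]
    congr 1
    funext a
    rw [← Complex.exp_add, Fin.sum_univ_castSucc]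
    congr 1
    ring

lemma trigPoly_eq_sum (K : ℕ) (c : ℤ → ℂ) (x : ℝ) :
    trigPoly K c x = c 0 + ∑ n : Fin K,
      (c (n + 1) * Complex.exp (Complex.I * (n + 1) * x)
        + c (-(n + 1)) * Complex.exp (-(Complex.I * (n + 1) * x))) := by
  rw [Fin.sum_univ_eq_sum_range (fun n : ℕ => c (n + 1) * Complex.exp (Complex.I * (n + 1) * x)
        + c (-(n + 1)) * Complex.exp (-(Complex.I * (n + 1) * x))) K]
  induction K with
  | zero => simp [trigPoly]
  | succ K ih =>
    rw [Finset.sum_range_succ, ← add_assoc, ← ih]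
    have : Finset.Icc (-((K + 1 : ℕ) : ℤ)) ((K + 1 : ℕ) : ℤ)
        = insert ((K : ℤ) + 1) (insert (-((K : ℤ) + 1)) (Finset.Icc (-(K : ℤ)) K)) := by
      ext n
      simp only [Finset.mem_Icc, Finset.mem_insert]
      omega
    rw [trigPoly, this, Finset.sum_insert (by simp; omega), Finset.sum_insert (by simp), trigPoly]
    push_cast
    ring_nf

/-- The Householder reflection in the hyperplane orthogonal to `w`. -/
noncomputable def householder {ι : Type} [Fintype ι] [DecidableEq ι] (w : ι → ℂ) : Matrix ι ι ℂ :=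
  1 - (((2 / ∑ a, ‖w a‖ ^ 2 : ℝ)) : ℂ) • vecMulVec w (star w)

lemma householder_mem_unitaryGroup {ι : Type} [Fintype ι] [DecidableEq ι] {w : ι → ℂ}
    (hw : ∑ a, ‖w a‖ ^ 2 ≠ 0) : householder w ∈ unitaryGroup ι ℂ := by
  have hs : (householder w)ᴴ = householder w := by
    rw [householder, conjTranspose_sub, conjTranspose_one, conjTranspose_smul,
      conjTranspose_vecMulVec, star_star, Complex.star_def, Complex.conj_ofReal]
  have hv : vecMulVec w (star w) * vecMulVec w (star w)
      = ((∑ a, ‖w a‖ ^ 2 : ℝ) : ℂ) • vecMulVec w (star w) := by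
    rw [vecMulVec_mul_vecMulVec]
    have : star w ⬝ᵥ w = ((∑ a, ‖w a‖ ^ 2 : ℝ) : ℂ) := by
      rw [dotProduct]
      push_cast
      exact Finset.sum_congr rfl fun a _ => Complex.conj_mul' (w a)
    rw [this, vecMulVec_smul]
  rw [mem_unitaryGroup_iff, star_eq_conjTranspose, hs, householder]
  set D := ∑ a, ‖w a‖ ^ 2
  have hD : (D : ℂ) ≠ 0 := by exact_mod_cast hw
  rw [Matrix.sub_mul, Matrix.mul_sub, Matrix.mul_sub, Matrix.one_mul, Matrix.mul_one,
    Matrix.one_mul, smul_mul_smul_comm, hv, smul_smul]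
  have : ((2 / D : ℝ) : ℂ) * ((2 / D : ℝ) : ℂ) * D = 2 * ((2 / D : ℝ) : ℂ) := by
    push_cast; field_simp
  rw [this, two_mul, add_smul]
  abel

section labels

variable {k K : ℕ}

/-- The labels of `k + 1` qubits that carry amplitudes: `0`, a label that is never observed, and
labels `A n` obtained from `s n`. The last qubit carries no gate; it separates the unobserved label
from the others. -/
def amplitudeLabel (s : Fin K → Fin k → Fin 2) : Option (Option (Fin K)) → Basis (k + 1)
  | none => 0
  | some none => Fin.snoc (α := fun _ => Fin 2) 0 1
  | some (some n) => Fin.snoc (α := fun _ => Fin 2) (s n) 0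

lemma amplitudeLabel_injective {e : Fin k → ℕ} {s : Fin K → Fin k → Fin 2}
    (hs : ∀ n, ∑ j, (s n j : ℕ) * 3 ^ e j = n + 1) : Function.Injective (amplitudeLabel s) := by
  let φ (a : Basis (k + 1)) : Fin 2 × ℕ :=
    (a (Fin.last k), ∑ j, (a (Fin.castSucc j) : ℕ) * 3 ^ e j)
  have h0 : φ (amplitudeLabel s none) = (0, 0) := by simp [φ, amplitudeLabel]
  have h1 : φ (amplitudeLabel s (some none)) = (1, 0) := by simp [φ, amplitudeLabel]
  have h2 (n : Fin K) : φ (amplitudeLabel s (some (some n))) = (0, (n : ℕ) + 1) := by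
    simp [φ, amplitudeLabel, hs]
  intro i j hij
  have h := congrArg φ hij
  clear hij
  clear_value φ
  rcases i with _ | _ | i <;> rcases j with _ | _ | j <;>
    simp_all [Fin.ext_iff]

/-- The amplitudes `1`, `r`, `y n` at the labels `amplitudeLabel s`. -/
noncomputable def amplitude (s : Fin K → Fin k → Fin 2) (r : ℝ) (y : Fin K → ℂ) :
    Basis (k + 1) → ℂ :=
  Function.extend (amplitudeLabel s)
    (fun | none => 1 | some none => (r : ℂ) | some (some n) => y n) 0

lemma sum_norm_amplitude {s : Fin K → Fin k → Fin 2} (hinj : Function.Injective (amplitudeLabel s))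
    (r : ℝ) (y : Fin K → ℂ) : ∑ a, ‖amplitude s r y a‖ ^ 2 = 1 + r ^ 2 + ∑ n, ‖y n‖ ^ 2 := by
  rw [← Fintype.sum_of_injective (amplitudeLabel s) hinj
    (fun i => ‖amplitude s r y (amplitudeLabel s i)‖ ^ 2)
    (fun a => ‖amplitude s r y a‖ ^ 2)
    (fun a ha => by
      rw [amplitude, Function.extend_apply' _ _ _ (by simpa using ha)]; simp) (fun _ => rfl)]
  simp only [Fintype.sum_option, amplitude, hinj.extend_apply]
  simp [add_assoc]

/-- The observable `u uᵀ + u τᵀ + τ uᵀ`, where `u` is the indicator of the label `0` and `τ` that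
of the labels `A n`. -/
def crossObservable (s : Fin K → Fin k → Fin 2) : Matrix (Basis (k + 1)) (Basis (k + 1)) ℂ :=
  let u : Basis (k + 1) → ℂ := fun a => if a = 0 then 1 else 0
  let τ : Basis (k + 1) → ℂ := fun a => ∑ n, if a = amplitudeLabel s (some (some n)) then 1 else 0
  Matrix.of fun a b => u a * u b + u a * τ b + τ a * u b

lemma isHermitian_crossObservable (s : Fin K → Fin k → Fin 2) :
    (crossObservable s).IsHermitian := by
  ext a b
  simp only [crossObservable, conjTranspose_apply, of_apply, star_add, star_mul', star_sum,
    apply_ite star, star_one, star_zero]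
  ring

lemma output_crossObservable (s : Fin K → Fin k → Fin 2)
    (U : Matrix (Basis (k + 1)) (Basis (k + 1)) ℂ) :
    output (crossObservable s) U = star (U 0 0) * U 0 0
      + ∑ n, (star (U 0 0) * U (amplitudeLabel s (some (some n))) 0
        + star (U (amplitudeLabel s (some (some n))) 0) * U 0 0) := by
  have h (u τ : Basis (k + 1) → ℂ) :
      ∑ a, ∑ b, star (U a 0) * (u a * u b + u a * τ b + τ a * u b) * U b 0
        = (∑ a, star (U a 0) * u a) * (∑ b, u b * U b 0)
          + (∑ a, star (U a 0) * u a) * (∑ b, τ b * U b 0)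
          + (∑ a, star (U a 0) * τ a) * (∑ b, u b * U b 0) := by
    simp only [Finset.sum_mul_sum, ← Finset.sum_add_distrib]
    exact Finset.sum_congr rfl fun a _ => Finset.sum_congr rfl fun b _ => by ring
  have h1 : ∑ a, star (U a 0) * (if a = 0 then 1 else 0 : ℂ) = star (U 0 0) := by simp
  have h2 : ∑ a, (if a = 0 then 1 else 0 : ℂ) * U a 0 = U 0 0 := by simp
  have h3 : ∑ a, (∑ n, if a = amplitudeLabel s (some (some n)) then 1 else 0 : ℂ) * U a 0
      = ∑ n, U (amplitudeLabel s (some (some n))) 0 := by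
    simp only [Finset.sum_mul]
    rw [Finset.sum_comm]
    simp
  have h4 : ∑ a, star (U a 0) * (∑ n, if a = amplitudeLabel s (some (some n)) then 1 else 0 : ℂ)
      = ∑ n, star (U (amplitudeLabel s (some (some n))) 0) := by
    simp only [Finset.mul_sum]
    rw [Finset.sum_comm]
    simp
  rw [output_eq_sum]
  refine (h (fun a => if a = 0 then 1 else 0)
    (fun a => ∑ n, if a = amplitudeLabel s (some (some n)) then 1 else 0)).trans ?_
  rw [h1, h2, h3, h4, Finset.sum_add_distrib, Finset.mul_sum, Finset.sum_mul]
  ring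

end labels

/-- The equations that express the coefficients by the amplitudes are solved explicitly. The first
one determines `D = 1 + r² + ∑ |y_n|²` as `2 / (1 - √c₀)`, the others then determine the `y_n`, and
the unobserved amplitude `r` is left to adjust `D`. -/
lemma exists_amplitudes {K : ℕ} {c : ℤ → ℂ} (hc : ∀ n, c (-n) = star (c n))
    (h0 : ‖c 0 - 1 / 4‖ < 1 / (16 * (K + 1)))
    (hn : ∀ n : Fin K, ‖c (-(n + 1))‖ < 1 / (16 * (K + 1))) :
    ∃ (r : ℝ) (y : Fin K → ℂ),
      (((1 - 2 / (1 + r ^ 2 + ∑ n, ‖y n‖ ^ 2) : ℝ) : ℂ)) ^ 2 = c 0 ∧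
      ∀ n : Fin K, ((1 - 2 / (1 + r ^ 2 + ∑ n, ‖y n‖ ^ 2) : ℝ) : ℂ)
        * (-((2 / (1 + r ^ 2 + ∑ n, ‖y n‖ ^ 2) : ℝ) : ℂ) * y n) = c (-(n + 1)) := by
  have hc0 : ((c 0).re : ℂ) = c 0 := by
    have := hc 0
    rw [neg_zero] at this
    exact Complex.conj_eq_iff_re.1 this.symm
  have hK : (0 : ℝ) ≤ K := K.cast_nonneg
  have hδ : 1 / (16 * ((K : ℝ) + 1)) ≤ 1 / 16 := by
    apply one_div_le_one_div_of_le <;> linarith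
  have hre : |(c 0).re - 1 / 4| < 1 / 16 := by
    have : ‖(((c 0).re - 1 / 4 : ℝ) : ℂ)‖ < 1 / (16 * (K + 1)) := by
      push_cast; rw [hc0]; exact h0
    rw [Complex.norm_real, Real.norm_eq_abs] at this
    linarith
  rw [abs_lt] at hre
  set ρ := Real.sqrt (c 0).re with hρ
  have hρ2 : ρ ^ 2 = (c 0).re := Real.sq_sqrt (by linarith)
  have hρ0 : 0 ≤ ρ := Real.sqrt_nonneg _
  have hρ1 : 2 / 5 < ρ := by nlinarith
  have hρ3 : ρ < 3 / 5 := by nlinarith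
  set D : ℝ := 2 / (1 - ρ) with hD
  have hD1 : 3 ≤ D := by rw [hD, le_div_iff₀ (by linarith)]; linarith
  have hD2 : D ≤ 5 := by rw [hD, div_le_iff₀ (by linarith)]; linarith
  have hDρ : 1 - 2 / D = ρ := by
    rw [hD]; field_simp [show 1 - ρ ≠ 0 by linarith]; ring
  set y : Fin K → ℂ := fun n => ((-(D / (2 * ρ)) : ℝ) : ℂ) * c (-(n + 1)) with hy
  have hyn (n : Fin K) : ‖y n‖ ^ 2 ≤ 1 / (K + 1) := by
    have h1 : ‖y n‖ = D / (2 * ρ) * ‖c (-(n + 1))‖ := by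
      rw [hy, norm_mul, Complex.norm_real, Real.norm_eq_abs, abs_neg,
        abs_of_nonneg (by positivity)]
    have h2 : D / (2 * ρ) ≤ 16 := by
      rw [div_le_iff₀ (by linarith)]; linarith
    have h3 : ‖y n‖ ≤ 1 / (K + 1) := by
      rw [h1]
      calc D / (2 * ρ) * ‖c (-(n + 1))‖ ≤ 16 * (1 / (16 * (K + 1))) :=
            mul_le_mul h2 (hn n).le (norm_nonneg _) (by norm_num)
        _ = 1 / (K + 1) := by field_simp
    have h4 : 1 / ((K : ℝ) + 1) ≤ 1 := by rw [div_le_one (by linarith)]; linarith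
    nlinarith [norm_nonneg (y n)]
  have hsum : ∑ n, ‖y n‖ ^ 2 ≤ 1 := by
    refine (Finset.sum_le_sum fun n _ => hyn n).trans ?_
    rw [Finset.sum_const, Finset.card_univ, Fintype.card_fin, nsmul_eq_mul, mul_one_div,
      div_le_one (by linarith)]
    linarith
  have hDD : 1 + Real.sqrt (D - 1 - ∑ n, ‖y n‖ ^ 2) ^ 2 + ∑ n, ‖y n‖ ^ 2 = D := by
    rw [Real.sq_sqrt (by linarith)]; ring
  refine ⟨Real.sqrt (D - 1 - ∑ n, ‖y n‖ ^ 2), y, ?_, fun n => ?_⟩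
  · rw [hDD, hDρ, ← hc0, ← hρ2]; push_cast; ring
  · rw [hDD, hDρ, hy]
    have h1 : (ρ : ℂ) ≠ 0 := by exact_mod_cast (by linarith : (0 : ℝ) < ρ).ne'
    have h2 : (D : ℂ) ≠ 0 := by exact_mod_cast (by linarith : (0 : ℝ) < D).ne'
    push_cast
    field_simp

lemma contDiff_householder {E : Type*} [NormedAddCommGroup E] [NormedSpace ℝ E] {ι : Type}
    [Fintype ι] [DecidableEq ι] {n : WithTop ℕ∞} {w : E → ι → ℂ}
    (hw : ∀ a, ContDiff ℝ n fun t => w t a) (h0 : ∀ t, ∑ a, ‖w t a‖ ^ 2 ≠ 0) (a b : ι) :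
    ContDiff ℝ n fun t => householder (w t) a b := by
  have h (t : E) : householder (w t) a b = (1 : Matrix ι ι ℂ) a b
      - ((2 / ∑ a, ‖w t a‖ ^ 2 : ℝ) : ℂ) * (w t a * star (w t b)) := by
    simp [householder, vecMulVec_apply]
  simp only [h]
  have hD : ContDiff ℝ n fun t => ∑ a, ‖w t a‖ ^ 2 := ContDiff.sum fun a _ => (hw a).norm_sq ℝ
  refine contDiff_const.sub (ContDiff.mul ?_ ((hw a).mul ?_))
  · exact Complex.ofRealCLM.contDiff.comp (contDiff_const.div hD h0)
  · exact Complex.conjCLE.contDiff.comp (hw b)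

lemma contDiff_amplitude {E : Type*} [NormedAddCommGroup E] [NormedSpace ℝ E] {k K : ℕ}
    {n : WithTop ℕ∞} {s : Fin K → Fin k → Fin 2} (hinj : Function.Injective (amplitudeLabel s))
    {r : E → ℝ} {y : E → Fin K → ℂ} (hr : ContDiff ℝ n r) (hy : ∀ i, ContDiff ℝ n fun t => y t i)
    (a : Basis (k + 1)) : ContDiff ℝ n fun t => amplitude s (r t) (y t) a := by
  by_cases ha : ∃ i, amplitudeLabel s i = a
  · obtain ⟨i, rfl⟩ := ha
    simp only [amplitude, hinj.extend_apply]
    rcases i with _ | _ | i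
    · exact contDiff_const
    · exact Complex.ofRealCLM.contDiff.comp hr
    · exact hy i
  · simp only [amplitude, Function.extend_apply' _ _ _ ha]
    exact contDiff_const

/-- The construction: the first ansatz layer prepares the state `ψ` with amplitudes
`ψ₀ = 1 - 2 / D`, `ψ_n = -2 y_n / D` (the first column of a Householder reflection), the gates
multiply these by phases whose quotients are `exp (-i (n + 1) x)`, and the observable picks up the
products `ψ̄₀ ψ_n` only. -/
theorem controlsCoeffs_of_subset_sums (P : Pauli) {k K : ℕ} {e : Fin k → ℕ}
    (hsub : ∀ n ≤ K, ∃ s : Fin k → Fin 2, ∑ j, (s j : ℕ) * 3 ^ e j = n) :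
    ControlsCoeffs P (ternary e) K (2 * K + 1) := by
  choose s hs using fun n : Fin K => hsub (n + 1) n.2
  have hinj := amplitudeLabel_injective hs
  obtain ⟨W₀, hW₀⟩ := exists_circuit_eq_diagonal P (fun j : Fin k => j.castSucc) (ternary e)
  let g : Unit ⊕ (Fin K ⊕ Fin K) ≃ Fin (2 * K + 1) :=
    Fintype.equivFinOfCardEq (by simp; omega)
  let r (t : Fin (2 * K + 1) → ℝ) : ℝ := t (g (Sum.inl ()))
  let y (t : Fin (2 * K + 1) → ℝ) (n : Fin K) : ℂ :=
    t (g (Sum.inr (Sum.inl n))) + t (g (Sum.inr (Sum.inr n))) * Complex.I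
  have hw (t : Fin (2 * K + 1) → ℝ) : ∑ a, ‖amplitude s (r t) (y t) a‖ ^ 2 ≠ 0 := by
    rw [sum_norm_amplitude hinj]
    positivity
  let R (t : Fin (2 * K + 1) → ℝ) : unitaryGroup (Basis (k + 1)) ℂ :=
    ⟨householder (amplitude s (r t) (y t)), householder_mem_unitaryGroup (hw t)⟩
  have hR (a b : Basis (k + 1)) : ContDiff ℝ ((⊤ : ℕ∞) : WithTop ℕ∞)
      fun t => (R t : Matrix (Basis (k + 1)) (Basis (k + 1)) ℂ) a b := by
    refine contDiff_householder (E := Fin (2 * K + 1) → ℝ)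
      (fun a => contDiff_amplitude hinj (contDiff_apply _ _ _) (fun n => ?_) a) hw a b
    exact (Complex.ofRealCLM.contDiff.comp (contDiff_apply _ _ _)).add
      ((Complex.ofRealCLM.contDiff.comp (contDiff_apply _ _ _)).mul contDiff_const)
  -- all the parameters belong to the first layer
  let d : Fin (k + 1) → ℕ := Fin.cons (α := fun _ => ℕ) (2 * K + 1) fun _ => 0
  let W : (j : Fin (k + 1)) → (Fin (d j) → ℝ) → unitaryGroup (Basis (k + 1)) ℂ :=
    Fin.cases (motive := fun j => (Fin (d j) → ℝ) → unitaryGroup (Basis (k + 1)) ℂ)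
      (fun t => W₀ 0 * R t) (fun j _ => W₀ j.succ)
  refine ⟨k + 1, fun j => j.castSucc, d, W, crossObservable s, fun j a b => ?_,
    isHermitian_crossObservable s, ?_, fun n => if n = 0 then 1 / 4 else 0, 1 / (16 * (K + 1)),
    fun n => ?_, by positivity, fun c hc hcδ => ?_⟩
  · refine Fin.cases (motive := fun j => ContDiff ℝ ((⊤ : ℕ∞) : WithTop ℕ∞)
      fun t => (W j t : Matrix (Basis (k + 1)) (Basis (k + 1)) ℂ) a b) ?_ (fun j => ?_) j
    · have h (t : Fin (2 * K + 1) → ℝ) :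
          ((W₀ 0 * R t : unitaryGroup (Basis (k + 1)) ℂ) : Matrix _ _ ℂ) a b
            = ∑ i, (W₀ 0 : Matrix (Basis (k + 1)) (Basis (k + 1)) ℂ) a i
              * (R t : Matrix (Basis (k + 1)) (Basis (k + 1)) ℂ) i b := rfl
      change ContDiff ℝ _ fun t : Fin (2 * K + 1) → ℝ =>
        ((W₀ 0 * R t : unitaryGroup (Basis (k + 1)) ℂ) : Matrix _ _ ℂ) a b
      simp only [h]
      exact ContDiff.sum fun i _ => contDiff_const.mul (hR i b)
    · change ContDiff ℝ _ fun _ : Fin 0 → ℝ => (W₀ j.succ : Matrix (Basis (k + 1)) _ ℂ) a b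
      exact contDiff_const
  · rw [Fin.sum_univ_succ]
    simp [d]
  · by_cases h : n = 0 <;> simp [h]
  · obtain ⟨r₁, y₁, h0, hn⟩ := exists_amplitudes hc (by simpa using hcδ 0) (fun n => by
      have := hcδ (-(n + 1))
      dsimp only at this
      rwa [if_neg (by omega), sub_zero] at this)
    let t : Fin (2 * K + 1) → ℝ := fun i => match g.symm i with
      | Sum.inl _ => r₁
      | Sum.inr (Sum.inl n) => (y₁ n).re
      | Sum.inr (Sum.inr n) => (y₁ n).im
    have hr : r t = r₁ := by simp [r, t]
    have hy : y t = y₁ := by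
      funext n
      simp only [y, t, Equiv.symm_apply_apply]
      exact Complex.re_add_im (y₁ n)
    refine ⟨Fin.cases (motive := fun j => Fin (d j) → ℝ) t (fun j i => 0), fun x => ?_⟩
    have hWt : (fun j => W j (Fin.cases (motive := fun j => Fin (d j) → ℝ) t (fun j i => 0) j))
        = Function.update W₀ 0 (W₀ 0 * R t) := by
      funext j
      refine Fin.cases ?_ (fun j => ?_) j
      · rw [Function.update_self]; rfl
      · rw [Function.update_of_ne (Fin.succ_ne_zero j)]; rfl
    have hU : circuit P (fun j : Fin k => j.castSucc) (ternary e)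
        (Function.update W₀ 0 (W₀ 0 * R t)) x
        = circuit P (fun j : Fin k => j.castSucc) (ternary e) W₀ x * R t :=
      interleave_update_zero _ _ _
    rw [hWt, hU, hW₀, output_crossObservable, trigPoly_eq_sum]
    simp only [diagonal_mul]
    set D : ℝ := 1 + r₁ ^ 2 + ∑ n, ‖y₁ n‖ ^ 2 with hD
    have hRa (i : Option (Option (Fin K))) :
        (R t : Matrix (Basis (k + 1)) (Basis (k + 1)) ℂ) (amplitudeLabel s i) 0
          = (if i = none then 1 else 0) - ((2 / D : ℝ) : ℂ)
            * amplitude s r₁ y₁ (amplitudeLabel s i) := by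
      have h1 : amplitude s r₁ y₁ 0 = 1 := hinj.extend_apply _ _ none
      have h2 : amplitudeLabel s i = 0 ↔ i = none :=
        ⟨fun h => hinj (h.trans (show 0 = amplitudeLabel s none from rfl)), by rintro rfl; rfl⟩
      simp only [R, hr, hy, householder, sum_norm_amplitude hinj, Matrix.sub_apply, one_apply, h2,
        Matrix.smul_apply, vecMulVec_apply, Pi.star_apply, h1, star_one, mul_one, smul_eq_mul, hD]
    have hR0 : (R t : Matrix (Basis (k + 1)) (Basis (k + 1)) ℂ) 0 0 = ((1 - 2 / D : ℝ) : ℂ) := by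
      have h1 : amplitude s r₁ y₁ (amplitudeLabel s none) = 1 := hinj.extend_apply _ _ none
      have h := hRa none
      rw [if_pos rfl, h1] at h
      refine h.trans ?_
      push_cast; ring
    have hRn (n : Fin K) : (R t : Matrix (Basis (k + 1)) (Basis (k + 1)) ℂ)
        (amplitudeLabel s (some (some n))) 0 = -((2 / D : ℝ) : ℂ) * y₁ n := by
      have h1 : amplitude s r₁ y₁ (amplitudeLabel s (some (some n))) = y₁ n :=
        hinj.extend_apply _ _ (some (some n))
      rw [hRa, h1, if_neg (by simp)]
      ring
    -- the phase at the label `A n` differs from that at `0` by the subset sum `n + 1`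
    have hphase (n : Fin K) : ∑ j, (ternary e j : ℂ)
          * (if amplitudeLabel s (some (some n)) j.castSucc = 0 then 1 / 2 else -(1 / 2))
        = ∑ j, (ternary e j : ℂ) * (if (0 : Basis (k + 1)) j.castSucc = 0 then 1 / 2 else -(1 / 2))
          - (n + 1) := by
      have : ((n : ℂ) + 1) = ∑ j, (ternary e j : ℂ) * ((s n j : ℕ) : ℂ) := by
        have := congrArg (Nat.cast : ℕ → ℂ) (hs n)
        push_cast at this
        rw [← this]
        refine Finset.sum_congr rfl fun j _ => ?_
        simp only [ternary]
        push_cast; ring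
      rw [this, ← Finset.sum_sub_distrib]
      refine Finset.sum_congr rfl fun j _ => ?_
      rw [← mul_sub]
      congr 1
      simp only [amplitudeLabel, Fin.snoc_castSucc, Pi.zero_apply, if_true]
      generalize s n j = b
      fin_cases b <;> norm_num
    set S := ∑ j, (ternary e j : ℂ)
      * (if (0 : Basis (k + 1)) j.castSucc = 0 then 1 / 2 else -(1 / 2)) with hS
    have hSr : (starRingEnd ℂ) S = S := by
      rw [hS, map_sum]
      simp [map_ofNat]
    have hstar (n : ℂ) (hn : (starRingEnd ℂ) n = n) :
        star (Complex.exp (Complex.I * x * (S - n)))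
          = Complex.exp (-(Complex.I * x * (S - n))) := by
      rw [Complex.star_def, ← Complex.exp_conj]
      simp [hSr, hn]
    have hstar0 : star (Complex.exp (Complex.I * x * S)) = Complex.exp (-(Complex.I * x * S)) := by
      simpa using hstar 0 (by simp)
    have hunit : Complex.exp (-(Complex.I * x * S)) * Complex.exp (Complex.I * x * S) = 1 := by
      rw [← Complex.exp_add]; simp
    have hreal (a : ℝ) : star (a : ℂ) = a := Complex.conj_ofReal a
    simp only [hphase, hR0, hRn]
    congr 1
    · rw [star_mul', hstar0, hreal, ← h0]
      linear_combination (((1 - 2 / D : ℝ) : ℂ)) ^ 2 * hunit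
    · refine Finset.sum_congr rfl fun n _ => ?_
      have e1 : Complex.exp (-(Complex.I * x * S)) * Complex.exp (Complex.I * x * (S - (n + 1)))
          = Complex.exp (-(Complex.I * (n + 1) * x)) := by
        rw [← Complex.exp_add]; congr 1; ring
      have e2 : Complex.exp (-(Complex.I * x * (S - (n + 1)))) * Complex.exp (Complex.I * x * S)
          = Complex.exp (Complex.I * (n + 1) * x) := by
        rw [← Complex.exp_add]; congr 1; ring
      have hcn : c (n + 1) = star (c (-(n + 1))) := by rw [← hc, neg_neg]
      rw [hcn, ← hn n, ← e1, ← e2]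
      simp only [star_mul', star_neg, hreal, hstar0, hstar (n + 1) (by simp)]
      ring

/-! ### Choice of the block sizes -/

lemma logb_three_le_self {x : ℝ} (hx : 1 ≤ x) : Real.logb 3 x ≤ x := by
  have h3 : 1 ≤ Real.log 3 := by
    rw [Real.le_log_iff_exp_le (by norm_num)]
    exact (Real.exp_one_lt_d9.trans (by norm_num)).le
  have h := Real.log_le_sub_one_of_pos (zero_lt_one.trans_le hx)
  rw [Real.logb, div_le_iff₀ (by linarith)]
  nlinarith

lemma half_le_logb_three_inv {ε : ℝ} (hε : 0 < ε) (hε' : ε ≤ 1 / 2) :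
    1 / 2 ≤ Real.logb 3 (1 / ε) := by
  have h2 : 1 ≤ Real.logb 3 (2 ^ 2) := by
    rw [Real.le_logb_iff_rpow_le (by norm_num) (by norm_num)]
    norm_num
  rw [Real.logb_pow] at h2
  have h : Real.logb 3 2 ≤ Real.logb 3 (1 / ε) :=
    Real.logb_le_logb_of_le (by norm_num) (by norm_num) (by rw [le_div_iff₀ hε]; linarith)
  push_cast at h2
  linarith

lemma exists_pow_three {x : ℝ} (hx : 1 < x) :
    ∃ m : ℕ, 1 ≤ m ∧ x ≤ 3 ^ m ∧ (3 : ℝ) ^ m ≤ 3 * x ∧ (m : ℝ) ≤ Real.logb 3 x + 1 := by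
  have hx0 : 0 < x := zero_lt_one.trans hx
  have hlog : 0 < Real.logb 3 x := Real.logb_pos (by norm_num) hx
  have hm := (Nat.ceil_lt_add_one hlog.le).le
  refine ⟨⌈Real.logb 3 x⌉₊, Nat.ceil_pos.2 hlog, ?_, ?_, hm⟩
  · rw [← Real.rpow_natCast, ← Real.logb_le_iff_le_rpow (by norm_num) hx0]
    exact Nat.le_ceil _
  · rw [← Real.rpow_natCast, ← Real.le_logb_iff_rpow_le (by norm_num) (by linarith),
      Real.logb_mul (by norm_num) hx0.ne', Real.logb_self_eq_one (by norm_num)]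
    linarith

/-- Sizes of a block that replaces one trainable gate up to an error `δ`: `16 ν` unit gates for the
fractional part of the frequency and `2 m` gates for the integer part. -/
lemma exists_block {A δ : ℝ} (hA : 1 ≤ A) (hδ : 0 < δ) (hδ' : δ ≤ 1 / 2) :
    ∃ ν m : ℕ, 1 ≤ ν ∧ 1 ≤ m ∧ (3 : ℝ) ^ m ≤ 9 * A ∧ (m : ℝ) ≤ Real.logb 3 A + 2 ∧
      (ν : ℝ) ≤ Real.logb 3 (1 / δ) + 3 ∧
      ∀ (P : Pauli) (α : ℝ), |α| ≤ A → ∃ F : ℝ → Matrix (Fin 2) (Fin 2) ℂ,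
        Realizable (fun _ : Unit => P.gen) (blockList (16 * ν) m) F ∧
        ∀ x ∈ Set.Icc (0 : ℝ) 1, ∃ r : ℝ, 0 ≤ r ∧ r ≤ δ ^ 2 / 2 ∧
          (F x - encGate P.gen α x)ᴴ * (F x - encGate P.gen α x) = (r : ℂ) • 1 := by
  obtain ⟨m, hm1, hm, hm', hml⟩ := exists_pow_three (x := 3 * A) (by linarith)
  have h8 : 16 ≤ 8 / δ := by rw [le_div_iff₀ hδ]; linarith
  obtain ⟨ν, hν1, hν, -, hνl⟩ := exists_pow_three (x := 8 / δ) (by linarith)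
  refine ⟨ν, m, hν1, hm1, by linarith, ?_, ?_, fun P α hα => ?_⟩
  · rw [Real.logb_mul (by norm_num) (by positivity), Real.logb_self_eq_one (by norm_num)] at hml
    linarith
  · rw [show 8 / δ = 8 * (1 / δ) by ring, Real.logb_mul (by norm_num) (by positivity)] at hνl
    have : Real.logb 3 8 ≤ 2 := by
      rw [Real.logb_le_iff_le_rpow (by norm_num) (by norm_num)]
      norm_num
    linarith
  · obtain ⟨F, hF, h⟩ := exists_gate_approx P hα (n := 4 * ν) (m := m) (by omega)
      ⟨2 * ν, by ring⟩ (by linarith)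
    refine ⟨F, by rwa [show 16 * ν = 4 * (4 * ν) by ring], fun x hx => ?_⟩
    obtain ⟨r, hr, hr', h⟩ := h x hx
    refine ⟨r, hr, hr'.trans ?_, h⟩
    have h1 : (1 / 2 : ℝ) ^ (4 * ν) ≤ ((3 ^ ν) ^ 2)⁻¹ := by
      rw [← pow_mul, mul_comm ν, pow_mul, pow_mul, ← inv_pow]
      exact pow_le_pow_left₀ (by norm_num) (by norm_num) ν
    have h2 : ((3 ^ ν : ℝ) ^ 2)⁻¹ ≤ ((8 / δ) ^ 2)⁻¹ := by gcongr
    have h3 : ((8 / δ) ^ 2)⁻¹ = δ ^ 2 / 64 := by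
      rw [← inv_pow, inv_div, div_pow]; norm_num
    nlinarith [sq_nonneg δ]

lemma range_get_rev {l : List ℕ} {m : ℕ} (h : ∀ i, i ∈ l ↔ i < m) :
    Set.range (fun j : Fin l.length => l.get j.rev) = Set.Iio m := by
  ext i
  rw [Set.mem_Iio, ← h, List.mem_iff_get, ← Fin.revPerm.exists_congr_right]
  rfl

end TernaryVQC

theorem mainTheorem2 :
    ∃ C : ℝ, 0 < C ∧
      -- one trainable-frequency gate
      (∀ A ε : ℝ, 1 ≤ A → 0 < ε → ε ≤ 1 / 2 →
        ∃ (k : ℕ) (e : Fin k → ℕ),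
          (k : ℝ) ≤ C * (Real.logb 3 A + Real.logb 3 (1 / ε)) ∧
          (∃ m : ℕ, Set.range e = Set.Iio m) ∧
          ∀ (P : TernaryVQC.Pauli) (α : ℝ), |α| ≤ A →
            ∃ W : Fin (k + 1) → Matrix.unitaryGroup (Fin 2) ℂ,
              ∀ x ∈ Set.Icc (0 : ℝ) 1,
                TernaryVQC.frobNorm
                  (TernaryVQC.interleave k
                      (fun j => TernaryVQC.encGate P.gen (TernaryVQC.ternary e j) x) W
                    - TernaryVQC.encGate P.gen α x) ≤ ε) ∧
      -- a complete trainable-frequency circuit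
      (∀ (kopt : ℕ) (ε : ℝ), 1 ≤ kopt → 0 < ε → ε ≤ 1 / 2 →
        ∃ (k : ℕ) (e : Fin k → ℕ) (kunary : ℕ),
          (k : ℝ) ≤ C * (kopt * (Real.logb 3 kopt + Real.logb 3 (1 / ε))) ∧
          (kunary : ℝ) ≤ C * ((kopt : ℝ) ^ 2 + kopt * (ε ^ 2)⁻¹) ∧
          (∃ m : ℕ, Set.range e = Set.Iio m) ∧
          ∀ P : TernaryVQC.Pauli,
            -- both the ternary gates and `kunary` unary gates approximate
            (∀ (q : ℕ) (loc : Fin kopt → Fin q) (α : Fin kopt → ℝ)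
                (W : Fin (kopt + 1) → Matrix.unitaryGroup (TernaryVQC.Basis q) ℂ),
              (∀ i, |α i| ≤ kopt) →
              TernaryVQC.ApproxBy ε P (TernaryVQC.ternary e) (TernaryVQC.circuit P loc α W) ∧
              TernaryVQC.ApproxBy ε P (TernaryVQC.unary kunary)
                (TernaryVQC.circuit P loc α W)) ∧
            -- the spectrum and its size, the same as for `kunary` unary gates
            TernaryVQC.freqSpectrum P (TernaryVQC.ternary e)
              = {ω : ℝ | ∃ n : ℤ, |n| ≤ (kunary : ℤ) ∧ ω = n} ∧
            (TernaryVQC.freqSpectrum P (TernaryVQC.ternary e)).ncard = 2 * kunary + 1 ∧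
            TernaryVQC.freqSpectrum P (TernaryVQC.unary kunary)
              = TernaryVQC.freqSpectrum P (TernaryVQC.ternary e) ∧
            -- every model output is a Fourier series over the spectrum
            (∀ (q : ℕ) (loc : Fin k → Fin q)
                (W : Fin (k + 1) → Matrix.unitaryGroup (TernaryVQC.Basis q) ℂ)
                (M : Matrix (TernaryVQC.Basis q) (TernaryVQC.Basis q) ℂ), M.IsHermitian →
              ∃ c : ℤ → ℂ, ∀ x : ℝ,
                TernaryVQC.output M (TernaryVQC.circuit P loc (TernaryVQC.ternary e) W x)
                  = TernaryVQC.trigPoly kunary c x) ∧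
            -- the number of ansatz parameters
            IsLeast {p : ℕ | TernaryVQC.ControlsCoeffs P (TernaryVQC.ternary e) kunary p}
              (2 * kunary + 1)) := by
  open TernaryVQC in
  refine ⟨200, by norm_num, fun A ε hA hε hε' => ?_, fun kopt ε hk hε hε' => ?_⟩
  · obtain ⟨ν, m, -, hm, -, hml, hνl, h⟩ := exists_block hA hε hε'
    refine ⟨_, fun j : Fin (blockList (16 * ν) m).length => (blockList (16 * ν) m).get j.rev, ?_,
      ⟨m, range_get_rev (mem_blockList hm)⟩, fun P α hα => ?_⟩
    · rw [length_blockList]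
      have h0 := Real.logb_nonneg (b := 3) (by norm_num) hA
      have h1 := half_le_logb_three_inv hε hε'
      push_cast
      linarith
    · obtain ⟨F, hF, h⟩ := h P α hα
      obtain ⟨-, W, hW⟩ := hF.exists_interleave
      refine ⟨W, fun x hx => ?_⟩
      obtain ⟨r, -, hr, h⟩ := h x hx
      rw [hW, frobNorm_eq_of_scalar h]
      exact Real.sqrt_le_iff.2 ⟨hε.le, by linarith⟩
  · have hk' : (1 : ℝ) ≤ kopt := by exact_mod_cast hk
    -- the errors of the `kopt` gates add up to `ε / 2`; an output has up to twice that error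
    set δ : ℝ := ε / (2 * kopt) with hδ
    have hδ0 : 0 < δ := by positivity
    have hδk : kopt * δ = ε / 2 := by rw [hδ]; field_simp
    have hδ' : δ ≤ 1 / 2 := by nlinarith
    obtain ⟨ν, m, hν, hm, hmA, hml, hνl, h⟩ := exists_block hk' hδ0 hδ'
    set l := (List.replicate kopt (blockList (16 * ν) m)).flatten with hl
    set K := (l.map (3 ^ ·)).sum with hK
    have hlen : l.length = kopt * (16 * ν + 2 * m) := by
      simp [hl, length_blockList]
    have hKs : K + kopt = kopt * (16 * ν + 3 ^ m) := by
      rw [← sum_blockList, mul_add, mul_one, hK, hl]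
      simp [List.map_flatten, List.sum_flatten]
    have hν' : (ν : ℝ) ≤ Real.logb 3 kopt + Real.logb 3 (1 / ε) + 4 := by
      have h2 : Real.logb 3 2 ≤ 1 := by
        rw [Real.logb_le_iff_le_rpow (by norm_num) (by norm_num)]
        norm_num
      rw [show 1 / δ = 2 * kopt * (1 / ε) by rw [hδ]; field_simp,
        Real.logb_mul (by positivity) (by positivity),
        Real.logb_mul (by norm_num) (by positivity)] at hνl
      linarith
    have h0 := Real.logb_nonneg (b := 3) (by norm_num) hk'
    have h1 := half_le_logb_three_inv hε hε'
    have hfill : FillsInterval l :=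
      fillsInterval_flatten kopt (fillsInterval_blockList _ _ (by omega))
    have hsub : ∀ n ≤ K, ∃ s : Fin l.length → Fin 2, ∑ j, (s j : ℕ) * 3 ^ l.get j.rev = n :=
      fun n hn => hfill.exists_sum hn
    refine ⟨l.length, fun j => l.get j.rev, K, ?_, ?_, ⟨m, range_get_rev fun i => ?_⟩,
      fun P => ?_⟩
    · rw [hlen]
      push_cast
      rw [mul_left_comm]
      gcongr
      linarith
    · have h2 : Real.logb 3 (1 / ε) ≤ (ε ^ 2)⁻¹ := by
        have hε1 : 1 ≤ 1 / ε := by rw [le_div_iff₀ hε]; linarith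
        refine (logb_three_le_self hε1).trans ?_
        rw [← inv_pow, ← one_div]
        nlinarith
      have h3 := logb_three_le_self hk'
      have h4 : 1 ≤ (ε ^ 2)⁻¹ := (one_le_inv₀ (by positivity)).2 (by nlinarith)
      have h5 : (K : ℝ) + kopt = kopt * (16 * ν + 3 ^ m) := by exact_mod_cast hKs
      have h6 : (16 * ν + 3 ^ m : ℝ) ≤ 200 * (kopt + (ε ^ 2)⁻¹) := by linarith
      nlinarith [mul_le_mul_of_nonneg_left h6 (zero_le_one.trans hk')]
    · rw [hl, List.mem_flatten]
      simp [← mem_blockList (N := 16 * ν) hm, List.mem_replicate]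
      omega
    · have hspec := freqSpectrum_ternary P (e := fun j : Fin l.length => l.get j.rev)
        (K := K) (sum_get_rev l) hsub
      refine ⟨fun q loc α W hα => ?_, hspec, ?_, ?_, fun q loc W M _ => ?_,
        controlsCoeffs_of_subset_sums P hsub, fun p hp => le_of_controlsCoeffs hp⟩
      · obtain ⟨F, hF, hFV⟩ := exists_circuit_approx hδ0.le (P := P)
          (fun α hα => by
            obtain ⟨F, hF, h⟩ := h P α hα
            refine ⟨F, hF, fun x hx => ?_⟩
            obtain ⟨r, hr, hr', h⟩ := h x hx
            exact ⟨r, hr, hr'.trans (half_le_self (sq_nonneg δ)), h⟩) loc α W hα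
        rw [hδk] at hFV
        have hV (x : ℝ) := circuit_mem_unitaryGroup P loc α W x
        exact ⟨approxBy_of_realizable hF hV hFV,
          approxBy_unary (approxBy_of_realizable hF.toUnary hV hFV)⟩
      · rw [hspec, ncard_integers]
      · rw [hspec, show unary K = ternary fun _ : Fin K => 0 by funext; simp [unary, ternary]]
        refine freqSpectrum_ternary P (by simp) fun n hn => ?_
        refine ⟨fun j => if (j : ℕ) < n then 1 else 0, ?_⟩
        simp [apply_ite, Fin.card_filter_val_lt, hn]
      · have hF := isTrigMatrix_circuit P loc (fun j => l.get j.rev) W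
        rw [sum_get_rev] at hF
        exact exists_output_eq_trigPoly hF M
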